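/- Let $\mathbb F$ be an algebraically closed field. Let $\mathcal C$ be a finite BTC over $\mathbb F$: a semisimple abelian $\mathbb F$-linear braided tensor category ($\otimes$ bilinear) with finite-dimensional $\mathrm{Hom}$-spaces, rigid and equipped with a ribbon structure (a natural automorphism $\theta$ of the identity functor with $\theta_{X\otimes Y}=(\theta_X\otimes\theta_Y)\circ c_{Y,X}\circ c_{X,Y}$ and $\theta_{X^*}=(\theta_X)^*$), with $\mathrm{End}\,\mathbf 1=\mathbb F\,\mathrm{id}_{\mathbf 1}$ and with finitely many isomorphism classes of simple objects. Let $\mathrm{Tr}_{\mathcal C}$ be the trace on $\mathcal C$ defined by duals, braiding and twist, $d(X)=\mathrm{Tr}_{\mathcal C}(\mathrm{id}_X)\in\mathbb F$ and $\dim\mathcal C=\sum_i d(X_i)^2$, where $X_i$ runs through representatives of the isomorphism classes of simple objects. Let $(\Gamma,m,\eta,\Delta,\varepsilon)$ be a commutative ($m\circ c_{\Gamma,\Gamma}=m$) strongly separable Frobenius algebra in $\mathcal C$, i.e. $(\Gamma,m,\eta)$ is a monoid, $(\Gamma,\Delta,\varepsilon)$ is a comonoid, $$(\mathrm{id}_\Gamma\otimes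 m)\circ(\Delta\otimes\mathrm{id}_\Gamma)=\Delta\circ m=(m\otimes\mathrm{id}_\Gamma)\circ(\mathrm{id}_\Gamma\otimes\Delta),$$ and $m\circ\Delta=\alpha\,\mathrm{id}_\Gamma$, $\varepsilon\circ\eta=\beta\,\mathrm{id}_{\mathbf 1}$ with $\alpha,\beta\in\mathbb F^*$. Assume $\dim_{\mathbb F}\mathrm{Hom}(\mathbf 1,\Gamma)=1$ and $\dim\Gamma:=d(\Gamma)\ne0$. Let $\Gamma\text{-}\mathrm{Mod}_{\mathcal C}$ be the category of left $\Gamma$-modules $(X,\mu)$ in $\mathcal C$, with unit object $(\Gamma,m)$ and tensor product $(X,\mu)\otimes(Y,\lambda)$ the coequalizer of $\mu\otimes\mathrm{id}_Y$ and $(\mathrm{id}_X\otimes\lambda)\circ(c_{\Gamma,X}\otimes\mathrm{id}_Y):\Gamma\otimes X\otimes Y\to X\otimes Y$. Then $\Gamma\text{-}\mathrm{Mod}_{\mathcal C}$ is a semisimple abelian $\mathbb F$-linear tensor category with finite-dimensional $\mathrm{Hom}$-spaces, with $\mathrm{End}_\Gamma\mathbf 1=\mathbb F\,\mathrm{id}_{\mathbf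 1}$ and with finitely many isomorphism classes of simple objects. It has duals and a spherical structure whose trace $\mathrm{Tr}_\Gamma$ satisfies $\mathrm{Tr}_{\mathcal C}(h)=\dim\Gamma\cdot\mathrm{Tr}_\Gamma(h)$ for all endomorphisms $h$ in $\Gamma\text{-}\mathrm{Mod}_{\mathcal C}$, and with respect to this structure $$\dim\,\Gamma\text{-}\mathrm{Mod}_{\mathcal C}=(\dim\Gamma)^{-1}\,\dim\mathcal C,$$ where $\dim\,\Gamma\text{-}\mathrm{Mod}_{\mathcal C}=\sum_j \mathrm{Tr}_\Gamma(\mathrm{id}_{Y_j})^2$ over representatives $Y_j$ of the isomorphism classes of simple modules. -/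

import Mathlib

open CategoryTheory CategoryTheory.Limits CategoryTheory.MonoidalCategory
open scoped MonObj ComonObj

universe w v u

namespace CategoryTheory

/-! ### Spherical categories -/

section Spherical

/-- A pivotal structure on a monoidal category with right duals: a monoidal natural isomorphism
from the identity functor to the double dual functor. Here `(rightDualTensorIso X Y).hom` is
`(X ⊗ Y)ᘁ ⟶ Yᘁ ⊗ Xᘁ`, and its mate is the canonical `Xᘁᘁ ⊗ Yᘁᘁ ⟶ (X ⊗ Y)ᘁᘁ`. Compatibility with
the unit object follows from `pivot_tensor`, because every `pivot X` is invertible. -/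
class PivotalCategory (D : Type u) [Category.{v} D] [MonoidalCategory D]
    [RightRigidCategory D] where
  pivot : ∀ X : D, X ≅ (Xᘁ)ᘁ
  pivot_naturality : ∀ {X Y : D} (f : X ⟶ Y), f ≫ (pivot Y).hom = (pivot X).hom ≫ (fᘁ)ᘁ
  pivot_tensor : ∀ X Y : D, (pivot (X ⊗ Y)).hom =
    ((pivot X).hom ⊗ₘ (pivot Y).hom) ≫
      @rightAdjointMate D _ _ ((X ⊗ Y)ᘁ) (Yᘁ ⊗ Xᘁ) _ hasRightDualTensor
        (rightDualTensorIso X Y).hom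

variable {D : Type u} [Category.{v} D] [MonoidalCategory D] [RightRigidCategory D]

/-- The trace of `f : X ⟶ X`, closing the strand on the right. -/
def rightTrace [PivotalCategory D] {X : D} (f : X ⟶ X) : 𝟙_ D ⟶ 𝟙_ D :=
  η_ X Xᘁ ≫ (f ≫ (PivotalCategory.pivot X).hom) ▷ Xᘁ ≫ ε_ Xᘁ (Xᘁ)ᘁ

/-- The trace of `f : X ⟶ X`, closing the strand on the left. -/
def leftTrace [PivotalCategory D] {X : D} (f : X ⟶ X) : 𝟙_ D ⟶ 𝟙_ D :=
  η_ Xᘁ (Xᘁ)ᘁ ≫ Xᘁ ◁ ((PivotalCategory.pivot X).inv ≫ f) ≫ ε_ X Xᘁ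

variable (D) in
/-- A spherical category: a pivotal category whose left and right traces agree. -/
class SphericalCategory extends PivotalCategory D where
  leftTrace_eq_rightTrace : ∀ {X : D} (f : X ⟶ X), leftTrace f = rightTrace f

end Spherical

/-! ### Ribbon categories -/

section Ribbon

/-- A ribbon structure on a braided category with right duals: a twist compatible with the tensor
product and with duals. (The twist of the unit object is then the identity.) -/
class RibbonCategory (C : Type u) [Category.{v} C] [MonoidalCategory C] [BraidedCategory C]
    [RightRigidCategory C] where
  twist : ∀ X : C, X ≅ X
  twist_naturality : ∀ {X Y : C} (f : X ⟶ Y), f ≫ (twist Y).hom = (twist X).hom ≫ f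
  twist_tensor : ∀ X Y : C, (twist (X ⊗ Y)).hom =
    (β_ X Y).hom ≫ (β_ Y X).hom ≫ ((twist X).hom ⊗ₘ (twist Y).hom)
  twist_dual : ∀ X : C, (twist (Xᘁ)).hom = ((twist X).hom)ᘁ

/-- The trace of an endomorphism in a ribbon category. -/
def ribbonTrace {C : Type u} [Category.{v} C] [MonoidalCategory C] [BraidedCategory C]
    [RightRigidCategory C] [RibbonCategory C] {X : C} (f : X ⟶ X) : 𝟙_ C ⟶ 𝟙_ C :=
  η_ X Xᘁ ≫ (f ≫ (RibbonCategory.twist X).hom) ▷ Xᘁ ≫ (β_ X Xᘁ).hom ≫ ε_ X Xᘁ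

end Ribbon

/-! ### Linear semisimple tensor categories and their dimension -/

section Linear

/-- A semisimple `F`-linear tensor category with finite-dimensional morphism spaces in which
`c ↦ c • 𝟙` is a bijection from `F` onto the endomorphisms of the unit object. -/
structure IsSemisimpleTensorCategory (F : Type w) [Field F] (D : Type u) [Category.{v} D]
    [Preadditive D] [Linear F D] [MonoidalCategory D] : Prop where
  bilinear : ∃ _ : MonoidalPreadditive D, MonoidalLinear F D
  abelian : ∃ A : Abelian D, A.toPreadditive = ‹Preadditive D›
  semisimple : ∀ X : D, ∃ (n : ℕ) (S : Fin n → D) (b : Limits.Bicone S),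
    (∀ i, Simple (S i)) ∧ Nonempty b.IsBilimit ∧ Nonempty (X ≅ b.pt)
  finite_hom : ∀ X Y : D, Module.Finite F (X ⟶ Y)
  end_unit : Function.Bijective (fun c : F => c • 𝟙 (𝟙_ D))

/-- The scalar `c` with `c • 𝟙 = f`, for an endomorphism `f` of the unit object. -/
noncomputable def unitScalar (F : Type w) [Field F] {D : Type u} [Category.{v} D]
    [Preadditive D] [Linear F D] [MonoidalCategory D] (f : 𝟙_ D ⟶ 𝟙_ D) : F :=
  Function.invFun (fun c : F => c • 𝟙 (𝟙_ D)) f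

/-- Isomorphism of simple objects. -/
def simpleSetoid (D : Type u) [Category.{v} D] [HasZeroMorphisms D] :
    Setoid {X : D // Simple X} :=
  (isIsomorphicSetoid D).comap Subtype.val

/-- The isomorphism classes of simple objects. -/
def SimpleClass (D : Type u) [Category.{v} D] [HasZeroMorphisms D] : Type u :=
  _root_.Quotient (simpleSetoid D)

/-- A representative of an isomorphism class of simple objects. -/
noncomputable def SimpleClass.rep {D : Type u} [Category.{v} D] [HasZeroMorphisms D]
    (c : SimpleClass D) : D :=
  (_root_.Quotient.out (s := simpleSetoid D) c).val

/-- The sum of `d(X)²` over the isomorphism classes of simple objects `X` (to be used when there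
are finitely many of them and `d` is invariant under isomorphism). -/
noncomputable def globalDim {F : Type w} [Field F] {D : Type u} [Category.{v} D]
    [HasZeroMorphisms D] (d : D → F) : F :=
  ∑ᶠ c : SimpleClass D, d c.rep ^ 2

/-- The dimension of an object of a ribbon category. -/
noncomputable def ribbonDim (F : Type w) [Field F] {C : Type u} [Category.{v} C] [Preadditive C]
    [Linear F C] [MonoidalCategory C] [BraidedCategory C] [RightRigidCategory C]
    [RibbonCategory C] (X : C) : F :=
  unitScalar F (ribbonTrace (𝟙 X))

/-- The dimension of an object of a spherical category. -/
noncomputable def sphericalDim (F : Type w) [Field F] {D : Type u} [Category.{v} D]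
    [Preadditive D] [Linear F D] [MonoidalCategory D] [RightRigidCategory D]
    [SphericalCategory D] (X : D) : F :=
  unitScalar F (rightTrace (𝟙 X))

end Linear

/-! ### Strongly separable Frobenius algebras -/

/-- A monoid and comonoid `Γ` is a strongly separable Frobenius algebra. -/
structure IsStronglySeparableFrobenius (F : Type w) [Field F] {C : Type u} [Category.{v} C]
    [Preadditive C] [Linear F C] [MonoidalCategory C] (Γ : C) [MonObj Γ] [ComonObj Γ] :
    Prop where
  frobenius_left : Δ[Γ] ▷ Γ ≫ (α_ Γ Γ Γ).hom ≫ Γ ◁ μ[Γ] = μ[Γ] ≫ Δ[Γ]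
  frobenius_right : Γ ◁ Δ[Γ] ≫ (α_ Γ Γ Γ).inv ≫ μ[Γ] ▷ Γ = μ[Γ] ≫ Δ[Γ]
  comul_mul : ∃ a : F, a ≠ 0 ∧ Δ[Γ] ≫ μ[Γ] = a • 𝟙 Γ
  unit_counit : ∃ b : F, b ≠ 0 ∧ η[Γ] ≫ ε[Γ] = b • 𝟙 (𝟙_ C)

/-! ### Modules: the linear structure

`Mod C Γ` is Mathlib's category of left modules `(X, γ : Γ ⊗ X ⟶ X)` in `C`. -/

namespace Mod

section Hom

variable {C : Type u} [Category.{v} C] [MonoidalCategory C] {Γ : C} [MonObj Γ]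

lemma smul_comp_hom {M N : Mod C Γ} (f : M ⟶ N) :
    γ[Γ, M.X] ≫ f.hom = Γ ◁ f.hom ≫ γ[Γ, N.X] :=
  IsModHom.smul_hom (A := Γ) (f := f.hom)

/-- A module morphism from a morphism of underlying objects. -/
def homMk {M N : Mod C Γ} (f : M.X ⟶ N.X) (h : γ[Γ, M.X] ≫ f = Γ ◁ f ≫ γ[Γ, N.X]) : M ⟶ N :=
  Mod.Hom.mk' f h

end Hom

section Linear

variable {C : Type u} [Category.{v} C] [Preadditive C] [MonoidalCategory C]
  [MonoidalPreadditive C] {Γ : C} [MonObj Γ]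

instance homAdd (M N : Mod C Γ) : Add (M ⟶ N) where
  add f g := homMk (f.hom + g.hom) (by
    rw [Preadditive.comp_add, smul_comp_hom, smul_comp_hom, MonoidalPreadditive.whiskerLeft_add,
      Preadditive.add_comp])

instance homZero (M N : Mod C Γ) : Zero (M ⟶ N) where
  zero := homMk 0 (by
    rw [comp_zero, MonoidalPreadditive.whiskerLeft_zero, zero_comp])

instance homNeg (M N : Mod C Γ) : Neg (M ⟶ N) where
  neg f := homMk (-f.hom) (by
    have h : Γ ◁ (-f.hom) = -(Γ ◁ f.hom) := (tensorLeft Γ).map_neg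
    rw [Preadditive.comp_neg, smul_comp_hom, h, Preadditive.neg_comp])

instance homAddCommGroup (M N : Mod C Γ) : AddCommGroup (M ⟶ N) where
  add_assoc f g h := Mod.hom_ext _ _ (add_assoc f.hom g.hom h.hom)
  zero_add f := Mod.hom_ext _ _ (zero_add f.hom)
  add_zero f := Mod.hom_ext _ _ (add_zero f.hom)
  neg_add_cancel f := Mod.hom_ext _ _ (neg_add_cancel f.hom)
  add_comm f g := Mod.hom_ext _ _ (add_comm f.hom g.hom)
  nsmul := nsmulRec
  zsmul := zsmulRec

instance preadditive : Preadditive (Mod C Γ) where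
  homGroup := homAddCommGroup
  add_comp _ _ _ f g h := Mod.hom_ext _ _ (Preadditive.add_comp _ _ _ f.hom g.hom h.hom)
  comp_add _ _ _ f g h := Mod.hom_ext _ _ (Preadditive.comp_add _ _ _ f.hom g.hom h.hom)

variable (F : Type w) [Field F] [Linear F C] [MonoidalLinear F C]

instance homModule (M N : Mod C Γ) : Module F (M ⟶ N) where
  smul c f := homMk (c • f.hom) (by
    rw [Linear.comp_smul, smul_comp_hom, MonoidalLinear.whiskerLeft_smul, Linear.smul_comp])
  one_smul f := Mod.hom_ext _ _ (one_smul F f.hom)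
  mul_smul c d f := Mod.hom_ext _ _ (mul_smul c d f.hom)
  smul_zero c := Mod.hom_ext _ _ (smul_zero c)
  smul_add c f g := Mod.hom_ext _ _ (smul_add c f.hom g.hom)
  add_smul c d f := Mod.hom_ext _ _ (add_smul c d f.hom)
  zero_smul f := Mod.hom_ext _ _ (zero_smul F f.hom)

instance linear : Linear F (Mod C Γ) where
  homModule := homModule F
  smul_comp _ _ _ r f g := Mod.hom_ext _ _ (Linear.smul_comp _ _ _ r f.hom g.hom)
  comp_smul _ _ _ f r g := Mod.hom_ext _ _ (Linear.comp_smul _ _ _ f.hom r g.hom)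

end Linear

/-! ### Modules over a commutative monoid: the tensor product

A module `M` becomes a `Γ`-`Γ`-bimodule with right action
`M ⊗ Γ ⟶ Γ ⊗ M ⟶ M` (inverse braiding, then left action), and `Mod C Γ` is in this way a full
subcategory, closed under the tensor product, of the monoidal category of `Γ`-`Γ`-bimodules.
The tensor product of `M` and `N` is the coequalizer of `(γ ∘ β⁻¹) ▷ N` and `M ◁ γ` on
`M ⊗ Γ ⊗ N`; after precomposing with the isomorphism `β_ Γ M ▷ N`, this is the coequalizer of
`γ ▷ N` and `(M ◁ γ) ∘ (β ▷ N)` on `Γ ⊗ M ⊗ N`. -/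

section Bimodule

variable {C : Type u} [Category.{v} C] [MonoidalCategory C] [BraidedCategory C]
  (Γ : C) [MonObj Γ]

lemma smul_whiskerRight_smul (M : Mod C Γ) :
    γ[Γ, M.X] ▷ Γ ≫ (β_ Γ M.X).inv ≫ γ[Γ, M.X] =
      (β_ Γ (Γ ⊗ M.X)).inv ≫ (α_ _ _ _).inv ≫ μ[Γ] ▷ M.X ≫ γ[Γ, M.X] := by
  rw [ModObj.mul_smul_self, Iso.inv_hom_id_assoc,
    BraidedCategory.braiding_inv_naturality_left_assoc]
  rfl

lemma balanced_aux (M N : Mod C Γ) {Q : C} (p : M.X ⊗ N.X ⟶ Q)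
    (hp : ((β_ Γ M.X).inv ≫ γ[Γ, M.X]) ▷ N.X ≫ p = ((α_ _ _ _).hom ≫ M.X ◁ γ[Γ, N.X]) ≫ p) :
    (α_ M.X N.X Γ).hom ≫ M.X ◁ ((β_ Γ N.X).inv ≫ γ[Γ, N.X]) ≫ p =
      (β_ Γ (M.X ⊗ N.X)).inv ≫ (α_ Γ M.X N.X).inv ≫ γ[Γ, M.X] ▷ N.X ≫ p := by
  simp only [comp_whiskerRight, Category.assoc] at hp
  rw [BraidedCategory.braiding_tensor_right_inv]
  simp only [Category.assoc, Iso.hom_inv_id_assoc]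
  rw [hp]
  simp

variable [IsCommMonObj Γ]

lemma braiding_inv_mul : (β_ Γ Γ).inv ≫ μ[Γ] = μ[Γ] := by
  rw [Iso.inv_comp_eq, IsCommMonObj.mul_comm]

/-- A module over a commutative monoid as a bimodule. -/
@[simps]
def toBimodObj (M : Mod C Γ) : Bimod (Mon.mk Γ) (Mon.mk Γ) where
  X := M.X
  actLeft := γ[Γ, M.X]
  one_actLeft := ModObj.one_smul_self Γ M.X
  left_assoc := ModObj.mul_smul_self Γ M.X
  actRight := (β_ Γ M.X).inv ≫ γ[Γ, M.X]
  actRight_one := by simp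
  right_assoc := by
    simp only [comp_whiskerRight, Category.assoc, smul_whiskerRight_smul]
    rw [BraidedCategory.braiding_inv_naturality_right_assoc,
      BraidedCategory.braiding_tensor_left_inv, BraidedCategory.braiding_tensor_right_inv]
    simp only [Category.assoc, Iso.hom_inv_id_assoc]
    rw [← comp_whiskerRight_assoc, braiding_inv_mul]
  middle_assoc := by
    rw [smul_whiskerRight_smul, BraidedCategory.braiding_tensor_right_inv]
    simp only [Category.assoc, Iso.hom_inv_id_assoc]
    rw [← comp_whiskerRight_assoc, braiding_inv_mul, ModObj.mul_smul_self]
    simp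

/-- The functor from modules to bimodules. -/
@[simps]
def toBimod : Mod C Γ ⥤ Bimod (Mon.mk Γ) (Mon.mk Γ) where
  obj := toBimodObj Γ
  map {M N} f :=
    { hom := f.hom
      left_act_hom := smul_comp_hom f
      right_act_hom := by
        change ((β_ Γ M.X).inv ≫ γ[Γ, M.X]) ≫ f.hom = f.hom ▷ Γ ≫ (β_ Γ N.X).inv ≫ γ[Γ, N.X]
        rw [Category.assoc, smul_comp_hom, BraidedCategory.braiding_inv_naturality_left_assoc] }

/-- Modules are a full subcategory of bimodules. -/
def fullyFaithfulToBimod : (toBimod Γ).FullyFaithful where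
  preimage {M N} f := homMk f.hom f.left_act_hom

instance toBimod_full : (toBimod Γ).Full := (fullyFaithfulToBimod Γ).full

instance toBimod_faithful : (toBimod Γ).Faithful := (fullyFaithfulToBimod Γ).faithful

end Bimodule

section Tensor

variable {C : Type u} [Category.{v} C] [MonoidalCategory C] [HasCoequalizers C]
  [∀ X : C, PreservesColimitsOfSize.{0, 0} (tensorLeft X)]
  [∀ X : C, PreservesColimitsOfSize.{0, 0} (tensorRight X)]

/-- The monoidal category of `A`-`A`-bimodules: endomorphisms of `A` in Mathlib's bicategory of
monoids and bimodules. -/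
@[reducible]
noncomputable def bimodMonoidal (A : Mon C) : MonoidalCategory (Bimod A A) :=
  letI : Bicategory (Mon C) := Bimod.monBicategory
  inferInstanceAs (MonoidalCategory (EndMonoidal A))

attribute [local instance] bimodMonoidal

variable [BraidedCategory C] (Γ : C) [MonObj Γ] [IsCommMonObj Γ]

lemma tensorBimod_actRight (M N : Mod C Γ) :
    (Bimod.tensorBimod (toBimodObj Γ M) (toBimodObj Γ N)).actRight =
      (β_ Γ (Bimod.TensorBimod.X (toBimodObj Γ M) (toBimodObj Γ N))).inv ≫
        (Bimod.tensorBimod (toBimodObj Γ M) (toBimodObj Γ N)).actLeft := by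
  refine (cancel_epi ((tensorRight _).map (coequalizer.π _ _))).1 ?_
  have h1 := Bimod.TensorBimod.π_tensor_id_actRight (toBimodObj Γ M) (toBimodObj Γ N)
  have h2 := Bimod.TensorBimod.whiskerLeft_π_actLeft (toBimodObj Γ M) (toBimodObj Γ N)
  refine h1.trans ?_
  refine Eq.trans ?_ (BraidedCategory.braiding_inv_naturality_left_assoc _ _ _).symm
  refine Eq.trans ?_ (congrArg (fun t => _ ≫ t) h2.symm)
  exact balanced_aux Γ M N _ (coequalizer.condition _ _)

/-- The tensor product of two modules: the coequalizer underlying the tensor product of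
bimodules, with its left action. -/
noncomputable def tensor (M N : Mod C Γ) : Mod C Γ :=
  letI : ModObj Γ (Bimod.TensorBimod.X (toBimodObj Γ M) (toBimodObj Γ N)) :=
    { smul := (Bimod.tensorBimod (toBimodObj Γ M) (toBimodObj Γ N)).actLeft
      one_smul := (Bimod.tensorBimod (toBimodObj Γ M) (toBimodObj Γ N)).one_actLeft
      mul_smul := (Bimod.tensorBimod (toBimodObj Γ M) (toBimodObj Γ N)).left_assoc }
  ⟨Bimod.TensorBimod.X (toBimodObj Γ M) (toBimodObj Γ N)⟩

/-- The tensor product of modules is that of bimodules (the underlying morphism is the identity). -/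
noncomputable def tensorIso (M N : Mod C Γ) :
    (toBimod Γ).obj M ⊗ (toBimod Γ).obj N ≅ (toBimod Γ).obj (tensor Γ M N) :=
  Bimod.isoOfIso (Iso.refl _)
    ((Category.comp_id _).trans (Eq.symm
      ((congrArg (fun t => t ≫ _) (whiskerLeft_id _ _)).trans (Category.id_comp _))))
    ((Category.comp_id _).trans (Eq.symm
      ((congrArg (fun t => t ≫ _) (id_whiskerRight _ _)).trans
        ((Category.id_comp _).trans (tensorBimod_actRight Γ M N).symm))))

/-- The unit bimodule comes from the module `Γ` (the underlying morphism is the identity). -/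
noncomputable def unitIso :
    𝟙_ (Bimod (Mon.mk Γ) (Mon.mk Γ)) ≅ (toBimod Γ).obj (regular Γ) :=
  Bimod.isoOfIso (Iso.refl _)
    ((Category.comp_id _).trans (Eq.symm
      ((congrArg (fun t => t ≫ _) (whiskerLeft_id _ _)).trans (Category.id_comp _))))
    ((Category.comp_id _).trans (Eq.symm
      ((congrArg (fun t => t ≫ _) (id_whiskerRight _ _)).trans
        ((Category.id_comp _).trans (braiding_inv_mul Γ)))))

/-- The data of the monoidal structure on modules, carried over from bimodules. -/
@[reducible]
noncomputable def monoidalStruct : MonoidalCategoryStruct (Mod C Γ) where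
  tensorObj := tensor Γ
  whiskerLeft M _ _ f := (toBimod Γ).preimage
    ((tensorIso Γ M _).inv ≫ (toBimod Γ).obj M ◁ (toBimod Γ).map f ≫ (tensorIso Γ M _).hom)
  whiskerRight f N := (toBimod Γ).preimage
    ((tensorIso Γ _ N).inv ≫ (toBimod Γ).map f ▷ (toBimod Γ).obj N ≫ (tensorIso Γ _ N).hom)
  tensorHom f g := (toBimod Γ).preimage
    ((tensorIso Γ _ _).inv ≫ ((toBimod Γ).map f ⊗ₘ (toBimod Γ).map g) ≫ (tensorIso Γ _ _).hom)
  tensorUnit := regular Γ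
  associator M N K := (toBimod Γ).preimageIso
    (((tensorIso Γ _ _).symm ≪≫ ((tensorIso Γ _ _).symm ⊗ᵢ .refl _))
      ≪≫ α_ ((toBimod Γ).obj M) ((toBimod Γ).obj N) ((toBimod Γ).obj K)
      ≪≫ ((.refl _ ⊗ᵢ tensorIso Γ _ _) ≪≫ tensorIso Γ _ _))
  leftUnitor M := (toBimod Γ).preimageIso
    (((tensorIso Γ _ _).symm ≪≫ ((unitIso Γ).symm ⊗ᵢ .refl _)) ≪≫ λ_ ((toBimod Γ).obj M))
  rightUnitor M := (toBimod Γ).preimageIso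
    (((tensorIso Γ _ _).symm ≪≫ (.refl _ ⊗ᵢ (unitIso Γ).symm)) ≪≫ ρ_ ((toBimod Γ).obj M))

/-- The monoidal category of modules over a commutative monoid in a braided category. -/
noncomputable instance monoidal : MonoidalCategory (Mod C Γ) :=
  letI := monoidalStruct Γ
  Monoidal.induced (toBimod Γ)
    { μIso := tensorIso Γ
      εIso := unitIso Γ
      whiskerLeft_eq := fun _ _ _ _ => Functor.map_preimage _ _
      whiskerRight_eq := fun _ _ => Functor.map_preimage _ _
      tensorHom_eq := fun _ _ => Functor.map_preimage _ _
      associator_eq := fun _ _ _ => Functor.map_preimage _ _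
      leftUnitor_eq := fun _ => Functor.map_preimage _ _
      rightUnitor_eq := fun _ => Functor.map_preimage _ _ }

end Tensor

end Mod

/-! ### Tensoring preserves colimits in rigid categories -/

section Rigid

variable {C : Type u} [Category.{v} C] [MonoidalCategory C]

instance tensorLeft_preservesColimits_of_rigid [LeftRigidCategory C] (X : C) :
    PreservesColimitsOfSize.{0, 0} (tensorLeft X) :=
  (tensorLeftAdjunction (ᘁX : C) X).leftAdjoint_preservesColimits

instance tensorRight_preservesColimits_of_rigid [RightRigidCategory C] (X : C) :
    PreservesColimitsOfSize.{0, 0} (tensorRight X) :=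
  (tensorRightAdjunction X Xᘁ).leftAdjoint_preservesColimits

end Rigid

end CategoryTheory

namespace CategoryTheory

namespace Mod

/-! After rescaling, the Frobenius structure is a counit together with a copairing, written κ = Σ eᵢ
⊗ eⁱ as if Γ had elements, such that xκ = κx, Σ eᵢeⁱ = 1, and κ is dual to the form counit(xy)
(`SeparableFrobenius`). The theorem rests on four uses of κ.

The twist of Γ is trivial. Put t = Σ θ(eᵢ)eⁱ. Commutativity makes θ multiplicative on Γ, so
centrality of κ gives θ(x)t = tx. Since Hom(1, Γ) is a line, t = c·1; since d(Γ) = counit(t) is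
nonzero, so is c, and therefore θ = id (`twist_mul_twistElement`, `twist_eq_id`).

Module pairings are pairings in `C`. Composition with the counit identifies Γ-linear maps M ⟶ Γ with
maps M ⟶ 1 in `C`, so a module map M ⊗ N ⟶ Γ is the same as a Γ-balanced pairing M ⊗ N ⟶ 1 in `C`
(`pairing_ext`, `pairing_ofPairing`). Thus the dual in `C`, with the transposed action, is a dual
module. As θ is trivial on Γ, the canonical isomorphism from an object to its double dual is
Γ-linear and gives a pivotal structure. Both traces of a module endomorphism, closed off with the
unit and the counit of Γ, become the ribbon trace in `C`. Hence the two traces agree, and the factor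
between Tr_Γ and the ribbon trace is counit(1) = d(Γ).

Semisimplicity is Maschke's argument. Semisimplicity of `C` gives each f some g with fgf = f.
Averaging g with κ makes it Γ-linear and keeps this identity (`hasGeneralizedInverses`). With split
idempotents, finite direct sums and finite-dimensional Hom-spaces, this makes the module category
abelian and semisimple.

The dimension is a double count. Over simple X in `C` and simple modules Y, expand one factor of Σ
d(Y)² by d(Y) = Σ dim Hom(X, Y) d(X). Since Hom(X, Y) = Hom_Γ(Γ ⊗ X, Y), the sum over Y is d(Γ ⊗ X)
= d(Γ)d(X), and the total is d(Γ) dim C (`sum_sq_ribbonDim`). Dividing by d(Γ)² passes to the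
dimensions of the module category. -/

lemma comp_chain {C : Type u} [Category.{v} C]
    {A₀ A₁ A₂ A₃ A₄ A₅ B₁ B₂ : C} {a : A₀ ⟶ A₁} {b : A₁ ⟶ A₂} {f : A₂ ⟶ A₃}
    {g : A₃ ⟶ A₄} {h : A₄ ⟶ A₅} {c : A₁ ⟶ A₃} {d : A₁ ⟶ A₄} {e : A₀ ⟶ B₁} {k : B₁ ⟶ B₂}
    {l : B₂ ⟶ A₄} {m : B₂ ⟶ A₅} (h1 : b ≫ f = c) (h2 : c ≫ g = d) (h3 : a ≫ d = e ≫ k ≫ l)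
    (h4 : l ≫ h = m) : a ≫ b ≫ f ≫ g ≫ h = e ≫ k ≫ m := by
  rw [reassoc_of% h1, reassoc_of% h2, reassoc_of% h3, h4]

/-! ### Actions, and the tensor product of modules as a quotient -/

section Act

variable {C : Type u} [Category.{v} C] [MonoidalCategory C] {Γ : C} [MonObj Γ]

/-- The action of a module, with the tensor product of `C` in its source. -/
def act (M : Mod C Γ) : Γ ⊗ M.X ⟶ M.X := γ[Γ, M.X]

@[simp]
lemma one_act (M : Mod C Γ) : η[Γ] ▷ M.X ≫ M.act = (λ_ M.X).hom := ModObj.one_smul_self Γ M.X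

lemma mul_act (M : Mod C Γ) : μ[Γ] ▷ M.X ≫ M.act = (α_ _ _ _).hom ≫ Γ ◁ M.act ≫ M.act :=
  ModObj.mul_smul_self Γ M.X

lemma act_hom {M N : Mod C Γ} (f : M ⟶ N) : M.act ≫ f.hom = Γ ◁ f.hom ≫ N.act :=
  smul_comp_hom f

/-- A module from an object with an action. -/
def ofAct (X : C) (a : Γ ⊗ X ⟶ X) (h₁ : η[Γ] ▷ X ≫ a = (λ_ X).hom)
    (h₂ : μ[Γ] ▷ X ≫ a = (α_ _ _ _).hom ≫ Γ ◁ a ≫ a) : Mod C Γ :=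
  letI : ModObj Γ X := { smul := a, one_smul := h₁, mul_smul := h₂ }
  ⟨X⟩

/-- A module morphism from a morphism commuting with the actions. -/
def homOfAct {M N : Mod C Γ} (f : M.X ⟶ N.X) (h : M.act ≫ f = Γ ◁ f ≫ N.act) : M ⟶ N :=
  homMk f h

end Act

section Tensor

variable {C : Type u} [Category.{v} C] [MonoidalCategory C] [HasCoequalizers C]
  [∀ X : C, PreservesColimitsOfSize.{0, 0} (tensorLeft X)]
  [∀ X : C, PreservesColimitsOfSize.{0, 0} (tensorRight X)]
  [BraidedCategory C] {Γ : C} [MonObj Γ] [IsCommMonObj Γ]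

/-- The right action of a module over a commutative monoid. -/
def ract (M : Mod C Γ) : M.X ⊗ Γ ⟶ M.X := (β_ Γ M.X).inv ≫ M.act

/-- The projection from the tensor product in `C` to the tensor product of modules. -/
noncomputable def proj (M N : Mod C Γ) : M.X ⊗ N.X ⟶ (M ⊗ N).X :=
  coequalizer.π ((toBimodObj Γ M).actRight ▷ (toBimodObj Γ N).X)
    ((α_ _ _ _).hom ≫ ((toBimodObj Γ M).X ◁ (toBimodObj Γ N).actLeft))

instance (M N : Mod C Γ) : Epi (proj M N) := by
  unfold proj; exact coequalizer.π_epi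

lemma proj_condition (M N : Mod C Γ) :
    M.ract ▷ N.X ≫ proj M N = (α_ _ _ _).hom ≫ M.X ◁ N.act ≫ proj M N :=
  (coequalizer.condition ((toBimodObj Γ M).actRight ▷ (toBimodObj Γ N).X)
    ((α_ _ _ _).hom ≫ ((toBimodObj Γ M).X ◁ (toBimodObj Γ N).actLeft))).trans
    (Category.assoc _ _ _)

/-- Descent of a balanced morphism to the tensor product of modules. -/
noncomputable def desc {M N : Mod C Γ} {Q : C} (p : M.X ⊗ N.X ⟶ Q)
    (hp : M.ract ▷ N.X ≫ p = (α_ _ _ _).hom ≫ M.X ◁ N.act ≫ p) : (M ⊗ N).X ⟶ Q :=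
  coequalizer.desc (f := ((toBimodObj Γ M).actRight ▷ (toBimodObj Γ N).X))
    (g := ((α_ _ _ _).hom ≫ ((toBimodObj Γ M).X ◁ (toBimodObj Γ N).actLeft))) p
    (hp.trans (Category.assoc _ _ _).symm)

@[simp]
lemma proj_desc {M N : Mod C Γ} {Q : C} (p : M.X ⊗ N.X ⟶ Q)
    (hp : M.ract ▷ N.X ≫ p = (α_ _ _ _).hom ≫ M.X ◁ N.act ≫ p) : proj M N ≫ desc p hp = p :=
  coequalizer.π_desc _ _

lemma proj_act (M N : Mod C Γ) :
    Γ ◁ proj M N ≫ (M ⊗ N).act = (α_ _ _ _).inv ≫ M.act ▷ N.X ≫ proj M N :=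
  Bimod.TensorBimod.whiskerLeft_π_actLeft (toBimodObj Γ M) (toBimodObj Γ N)

section

attribute [local instance] bimodMonoidal

/-- The comparisons `tensorIso` and `unitIso` are identities on underlying objects, so structure
morphisms of modules unfold to those of bimodules. This lemma and its analogues serve only to derive
the `proj_…` formulas, which later arguments use instead of bimodules. -/
lemma map_whiskerRight_hom {M M' : Mod C Γ} (f : M ⟶ M') (N : Mod C Γ) :
    (f ▷ N).hom = (Bimod.whiskerRight ((toBimod Γ).map f) (toBimodObj Γ N)).hom := by
  have h : (toBimod Γ).map (f ▷ N) = (tensorIso Γ M N).inv ≫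
      (toBimod Γ).map f ▷ (toBimod Γ).obj N ≫ (tensorIso Γ M' N).hom :=
    Functor.map_preimage _ _
  refine (congrArg Bimod.Hom.hom h).trans ?_
  exact (Category.id_comp (_ ≫ 𝟙 _)).trans (Category.comp_id _)

lemma map_whiskerLeft_hom (M : Mod C Γ) {N N' : Mod C Γ} (f : N ⟶ N') :
    (M ◁ f).hom = (Bimod.whiskerLeft (toBimodObj Γ M) ((toBimod Γ).map f)).hom := by
  have h : (toBimod Γ).map (M ◁ f) = (tensorIso Γ M N).inv ≫
      (toBimod Γ).obj M ◁ (toBimod Γ).map f ≫ (tensorIso Γ M N').hom :=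
    Functor.map_preimage _ _
  refine (congrArg Bimod.Hom.hom h).trans ?_
  exact (Category.id_comp (_ ≫ 𝟙 _)).trans (Category.comp_id _)

lemma leftUnitor_hom_hom (M : Mod C Γ) :
    (λ_ M).hom.hom = (Bimod.whiskerRight (unitIso Γ).inv (toBimodObj Γ M)).hom ≫
      (Bimod.leftUnitorBimod (toBimodObj Γ M)).hom.hom := by
  have h : (toBimod Γ).map (λ_ M).hom = ((tensorIso Γ _ M).inv ≫
      ((unitIso Γ).inv ⊗ₘ 𝟙 _)) ≫ (λ_ ((toBimod Γ).obj M)).hom :=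
    Functor.map_preimage _ _
  rw [tensorHom_id] at h
  refine (congrArg Bimod.Hom.hom h).trans ?_
  exact (Category.assoc _ _ _).trans (Category.id_comp _)

lemma rightUnitor_hom_hom (M : Mod C Γ) :
    (ρ_ M).hom.hom = (Bimod.whiskerLeft (toBimodObj Γ M) (unitIso Γ).inv).hom ≫
      (Bimod.rightUnitorBimod (toBimodObj Γ M)).hom.hom := by
  have h : (toBimod Γ).map (ρ_ M).hom = ((tensorIso Γ M _).inv ≫
      (𝟙 _ ⊗ₘ (unitIso Γ).inv)) ≫ (ρ_ ((toBimod Γ).obj M)).hom :=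
    Functor.map_preimage _ _
  rw [id_tensorHom] at h
  refine (congrArg Bimod.Hom.hom h).trans ?_
  exact (Category.assoc _ _ _).trans (Category.id_comp _)

lemma associator_hom_hom (M N K : Mod C Γ) :
    (α_ M N K).hom.hom = (Bimod.whiskerRight (tensorIso Γ M N).inv (toBimodObj Γ K)).hom ≫
      (Bimod.associatorBimod (toBimodObj Γ M) (toBimodObj Γ N) (toBimodObj Γ K)).hom.hom ≫
      (Bimod.whiskerLeft (toBimodObj Γ M) (tensorIso Γ N K).hom).hom := by
  have h : (toBimod Γ).map (α_ M N K).hom = ((tensorIso Γ _ K).inv ≫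
      ((tensorIso Γ M N).inv ⊗ₘ 𝟙 _)) ≫
      (α_ ((toBimod Γ).obj M) ((toBimod Γ).obj N) ((toBimod Γ).obj K)).hom ≫
      ((𝟙 _ ⊗ₘ (tensorIso Γ N K).hom) ≫ (tensorIso Γ M _).hom) :=
    Functor.map_preimage _ _
  rw [id_tensorHom, tensorHom_id] at h
  refine (congrArg Bimod.Hom.hom h).trans ?_
  refine (Category.assoc _ _ _).trans ((Category.id_comp _).trans ?_)
  exact congrArg (fun t => _ ≫ _ ≫ t) (Category.comp_id _)

end

lemma proj_whiskerRight {M M' : Mod C Γ} (f : M ⟶ M') (N : Mod C Γ) :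
    proj M N ≫ (f ▷ N).hom = f.hom ▷ N.X ≫ proj M' N := by
  rw [map_whiskerRight_hom]
  exact ι_colimMap _ _

lemma proj_whiskerLeft (M : Mod C Γ) {N N' : Mod C Γ} (f : N ⟶ N') :
    proj M N ≫ (M ◁ f).hom = M.X ◁ f.hom ≫ proj M N' := by
  rw [map_whiskerLeft_hom]
  exact ι_colimMap _ _

lemma proj_leftUnitor (M : Mod C Γ) : proj (𝟙_ (Mod C Γ)) M ≫ (λ_ M).hom.hom = M.act := by
  rw [leftUnitor_hom_hom]
  have h1 : proj (𝟙_ (Mod C Γ)) M ≫ (Bimod.whiskerRight (unitIso Γ).inv (toBimodObj Γ M)).hom =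
    coequalizer.π _ _ := (ι_colimMap _ _).trans
      ((congrArg (fun t => t ≫ _) (id_whiskerRight _ _)).trans (Category.id_comp _))
  refine (Category.assoc _ _ _).symm.trans ((congrArg (fun t => t ≫ _) h1).trans ?_)
  exact coequalizer.π_desc _ _

lemma proj_rightUnitor (M : Mod C Γ) : proj M (𝟙_ (Mod C Γ)) ≫ (ρ_ M).hom.hom = M.ract := by
  rw [rightUnitor_hom_hom]
  have h1 : proj M (𝟙_ (Mod C Γ)) ≫ (Bimod.whiskerLeft (toBimodObj Γ M) (unitIso Γ).inv).hom =
    coequalizer.π _ _ := (ι_colimMap _ _).trans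
      ((congrArg (fun t => t ≫ _) (whiskerLeft_id _ _)).trans (Category.id_comp _))
  refine (Category.assoc _ _ _).symm.trans ((congrArg (fun t => t ≫ _) h1).trans ?_)
  exact coequalizer.π_desc _ _

/-- Tensoring preserves epimorphisms here, so the two projections on the left compose to an
epimorphism and this formula determines the associator. -/
lemma proj_associator (M N K : Mod C Γ) :
    proj M N ▷ K.X ≫ proj (M ⊗ N) K ≫ (α_ M N K).hom.hom =
      (α_ _ _ _).hom ≫ M.X ◁ proj N K ≫ proj M (N ⊗ K) := by
  rw [associator_hom_hom]
  have h1 : proj (M ⊗ N) K ≫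
      (Bimod.whiskerRight (tensorIso Γ M N).inv (toBimodObj Γ K)).hom =
    coequalizer.π _ _ := (ι_colimMap _ _).trans
      ((congrArg (fun t => t ≫ _) (id_whiskerRight _ _)).trans (Category.id_comp _))
  have h2 : coequalizer.π _ _ ≫
      (Bimod.associatorBimod (toBimodObj Γ M) (toBimodObj Γ N) (toBimodObj Γ K)).hom.hom =
      Bimod.AssociatorBimod.homAux (toBimodObj Γ M) (toBimodObj Γ N) (toBimodObj Γ K) :=
    coequalizer.π_desc _ _
  have h3 : proj M N ▷ K.X ≫
      Bimod.AssociatorBimod.homAux (toBimodObj Γ M) (toBimodObj Γ N) (toBimodObj Γ K) =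
      (α_ _ _ _).hom ≫ M.X ◁ proj N K ≫ coequalizer.π _ _ :=
    π_tensor_id_preserves_coequalizer_inv_desc _ _ _ _
  have h4 : coequalizer.π _ _ ≫
      (Bimod.whiskerLeft (toBimodObj Γ M) (tensorIso Γ N K).hom).hom = proj M (N ⊗ K) :=
    (ι_colimMap _ _).trans
      ((congrArg (fun t => t ≫ _) (whiskerLeft_id _ _)).trans (Category.id_comp _))
  exact comp_chain h1 h2 h3 h4

lemma proj_associator_inv (M N K : Mod C Γ) :
    M.X ◁ proj N K ≫ proj M (N ⊗ K) ≫ (α_ M N K).inv.hom =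
      (α_ _ _ _).inv ≫ proj M N ▷ K.X ≫ proj (M ⊗ N) K := by
  rw [← cancel_epi (α_ M.X N.X K.X).hom, ← reassoc_of% (proj_associator M N K), ← comp_hom',
    Iso.hom_inv_id]
  simp

instance whiskerRight_epi {X Y : C} (f : X ⟶ Y) [Epi f] (Z : C) : Epi (f ▷ Z) :=
  inferInstanceAs (Epi ((tensorRight Z).map f))

instance whiskerLeft_epi {X Y : C} (f : X ⟶ Y) [Epi f] (Z : C) : Epi (Z ◁ f) :=
  inferInstanceAs (Epi ((tensorLeft Z).map f))

lemma tensor_hom_ext {M N : Mod C Γ} {Q : C} {f g : (M ⊗ N).X ⟶ Q}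
    (h : proj M N ≫ f = proj M N ≫ g) : f = g :=
  (cancel_epi _).1 h

end Tensor

/-! ### Linearity of the tensor product of modules -/

section Linear

variable {C : Type u} [Category.{v} C] [Preadditive C] [MonoidalCategory C]
  [MonoidalPreadditive C] {Γ : C} [MonObj Γ]

lemma add_hom {M N : Mod C Γ} (f g : M ⟶ N) : (f + g).hom = f.hom + g.hom := rfl

lemma zero_hom {M N : Mod C Γ} : (0 : M ⟶ N).hom = 0 := rfl

lemma smul_hom {F : Type w} [Field F] [Linear F C] [MonoidalLinear F C] {M N : Mod C Γ} (c : F)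
    (f : M ⟶ N) : (c • f).hom = c • f.hom := rfl

variable [HasCoequalizers C]
  [∀ X : C, PreservesColimitsOfSize.{0, 0} (tensorLeft X)]
  [∀ X : C, PreservesColimitsOfSize.{0, 0} (tensorRight X)]
  [BraidedCategory C] [IsCommMonObj Γ]

instance monoidalPreadditive : MonoidalPreadditive (Mod C Γ) where
  whiskerLeft_zero := Mod.hom_ext _ _ (tensor_hom_ext (by simp [proj_whiskerLeft, zero_hom]))
  zero_whiskerRight := Mod.hom_ext _ _ (tensor_hom_ext (by simp [proj_whiskerRight, zero_hom]))
  whiskerLeft_add f g := Mod.hom_ext _ _ (tensor_hom_ext (by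
    simp only [proj_whiskerLeft, add_hom, Preadditive.comp_add,
      MonoidalPreadditive.whiskerLeft_add, Preadditive.add_comp]))
  add_whiskerRight f g := Mod.hom_ext _ _ (tensor_hom_ext (by
    simp only [proj_whiskerRight, add_hom, Preadditive.comp_add,
      MonoidalPreadditive.add_whiskerRight, Preadditive.add_comp]))

instance monoidalLinear (F : Type w) [Field F] [Linear F C] [MonoidalLinear F C] :
    MonoidalLinear F (Mod C Γ) where
  whiskerLeft_smul M _ _ r f := Mod.hom_ext _ _ (tensor_hom_ext (by
    simp only [proj_whiskerLeft, smul_hom, Linear.comp_smul,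
      MonoidalLinear.whiskerLeft_smul, Linear.smul_comp]))
  smul_whiskerRight r _ _ f M := Mod.hom_ext _ _ (tensor_hom_ext (by
    simp only [proj_whiskerRight, smul_hom, Linear.comp_smul,
      MonoidalLinear.smul_whiskerRight, Linear.smul_comp]))

end Linear

end Mod

/-! ### Morphisms into a dual object -/

section Pairing

variable {C : Type u} [Category.{v} C] [MonoidalCategory C]

/-- Nondegeneracy of the evaluation, from the bijection Hom(Z, X') ≅ Hom(Z ⊗ X, 1). Later identities
between morphisms into duals are reduced to identities of pairings in this way. -/
lemma ev_ext {X X' Z : C} [ExactPairing X X'] {f g : Z ⟶ X'}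
    (h : f ▷ X ≫ ε_ X X' = g ▷ X ≫ ε_ X X') : f = g := by
  let _ : HasRightDual X := ⟨X'⟩
  have hf := tensorRightHomEquiv_whiskerRight_comp_evaluation (X := X) f
  have hg := tensorRightHomEquiv_whiskerRight_comp_evaluation (X := X) g
  have := congrArg (tensorRightHomEquiv Z X X' (𝟙_ C)) h
  exact (cancel_mono (λ_ X').inv).1 (hf.symm.trans (this.trans hg))

/-- The morphism to the dual that corresponds to a pairing. -/
noncomputable def toDual {X X' Z : C} [ExactPairing X X'] (b : Z ⊗ X ⟶ 𝟙_ C) : Z ⟶ X' :=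
  tensorRightHomEquiv Z X X' (𝟙_ C) b ≫ (λ_ X').hom

lemma toDual_ev {X X' Z : C} [ExactPairing X X'] (b : Z ⊗ X ⟶ 𝟙_ C) :
    toDual b ▷ X ≫ ε_ X X' = b := by
  let _ : HasRightDual X := ⟨X'⟩
  apply (tensorRightHomEquiv Z X X' (𝟙_ C)).injective
  refine (tensorRightHomEquiv_whiskerRight_comp_evaluation (X := X) (toDual b)).trans ?_
  exact (Category.assoc _ _ _).trans
    ((congrArg (fun t => _ ≫ t) (λ_ X').hom_inv_id).trans (Category.comp_id _))

lemma rightDualIso_hom_ev {X Y₁ Y₂ : C} (p₁ : ExactPairing X Y₁) (p₂ : ExactPairing X Y₂) :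
    (rightDualIso p₁ p₂).hom ▷ X ≫ ε_ X Y₂ = ε_ X Y₁ := by
  have := @rightAdjointMate_comp_evaluation C _ _ X X ⟨Y₂⟩ ⟨Y₁⟩ (𝟙 X)
  refine this.trans ?_
  simp

lemma coev_rightDualIso_hom {X Y₁ Y₂ : C} (p₁ : ExactPairing X Y₁) (p₂ : ExactPairing X Y₂) :
    η_ X Y₁ ≫ X ◁ (rightDualIso p₁ p₂).hom = η_ X Y₂ := by
  have := @coevaluation_comp_rightAdjointMate C _ _ X X ⟨Y₂⟩ ⟨Y₁⟩ (𝟙 X)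
  refine this.trans ?_
  simp

end Pairing

/-! ### Reversed evaluation and trace in a ribbon category -/

section Ribbon

open RibbonCategory

variable {C : Type u} [Category.{v} C] [MonoidalCategory C] [BraidedCategory C]

/-- A strand slides past a pairing: naturality of the braiding in the pairing, with the hexagon to
split the crossing. -/
lemma braiding_pairing_left {X X' : C} (Y : C) (k : X ⊗ X' ⟶ 𝟙_ C) :
    X ◁ (β_ Y X').hom ⊗≫ k ▷ Y =
      𝟙 _ ⊗≫ (β_ Y X).inv ▷ X' ⊗≫ Y ◁ k ⊗≫ 𝟙 _ := by
  have h := BraidedCategory.braiding_naturality_right Y k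
  rw [BraidedCategory.braiding_tensor_right_hom, braiding_tensorUnit_right] at h
  calc _ = 𝟙 _ ⊗≫ ((β_ Y X).inv ≫ (β_ Y X).hom) ▷ X' ⊗≫ X ◁ (β_ Y X').hom ⊗≫ k ▷ Y := by
        rw [Iso.inv_hom_id]; monoidal
    _ = 𝟙 _ ⊗≫ (β_ Y X).inv ▷ X' ⊗≫ (((α_ Y X X').inv ≫ (β_ Y X).hom ▷ X' ≫ (α_ X Y X').hom ≫
          X ◁ (β_ Y X').hom ≫ (α_ X X' Y).inv) ≫ k ▷ Y) := by monoidal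
    _ = _ := by rw [← h]; monoidal

lemma braiding_pairing_right {Y Y' : C} (X : C) (k : Y ⊗ Y' ⟶ 𝟙_ C) :
    (β_ X Y).hom ▷ Y' ⊗≫ Y ◁ (β_ X Y').hom ⊗≫ k ▷ X = 𝟙 _ ⊗≫ X ◁ k ⊗≫ 𝟙 _ := by
  have h := BraidedCategory.braiding_naturality_right X k
  rw [BraidedCategory.braiding_tensor_right_hom, braiding_tensorUnit_right] at h
  calc _ = 𝟙 _ ⊗≫ (((α_ X Y Y').inv ≫ (β_ X Y).hom ▷ Y' ≫ (α_ Y X Y').hom ≫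
          Y ◁ (β_ X Y').hom ≫ (α_ Y Y' X).inv) ≫ k ▷ X) := by monoidal
    _ = _ := by rw [← h]; monoidal

/-- Sliding the strand Y past the closed pairing of X with X' produces an inverse crossing, which
cancels one half of the double braiding. The other half is absorbed when X slides past the pairing
of Y with Y', leaving two nested pairings. -/
lemma double_braiding_tensor_evaluation (X Y X' Y' : C) [ExactPairing X X'] [ExactPairing Y Y'] :
    ((β_ X Y).hom ≫ (β_ Y X).hom) ▷ (Y' ⊗ X') ≫ (β_ (X ⊗ Y) (Y' ⊗ X')).hom ≫
        ε_ (X ⊗ Y) (Y' ⊗ X') =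
      𝟙 _ ⊗≫ X ◁ (((β_ Y Y').hom ≫ ε_ Y Y') ▷ X') ⊗≫ ((β_ X X').hom ≫ ε_ X X') := by
  rw [ExactPairing.tensor_evaluation]
  calc _ = ((β_ X Y).hom ≫ (β_ Y X).hom) ▷ (Y' ⊗ X') ⊗≫ (β_ (X ⊗ Y) Y').hom ▷ X' ⊗≫
          Y' ◁ (X ◁ (β_ Y X').hom ⊗≫ ((β_ X X').hom ≫ ε_ X X') ▷ Y) ⊗≫ ε_ Y Y' := by
        rw [BraidedCategory.braiding_tensor_right_hom (X ⊗ Y),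
          BraidedCategory.braiding_tensor_left_hom X Y X']
        monoidal
    _ = ((β_ X Y).hom ≫ (β_ Y X).hom) ▷ (Y' ⊗ X') ⊗≫
          ((β_ (X ⊗ Y) Y').hom ≫ Y' ◁ (β_ Y X).inv) ▷ X' ⊗≫
          ((Y' ⊗ Y) ◁ ((β_ X X').hom ≫ ε_ X X') ≫ ε_ Y Y' ▷ (𝟙_ C)) ⊗≫ 𝟙 _ := by
        rw [braiding_pairing_left]; monoidal
    _ = ((β_ X Y).hom ≫ (β_ Y X).hom ≫ (β_ Y X).inv) ▷ (Y' ⊗ X') ⊗≫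
          (β_ (Y ⊗ X) Y').hom ▷ X' ⊗≫
          ε_ Y Y' ▷ (X ⊗ X') ⊗≫ ((β_ X X').hom ≫ ε_ X X') := by
        rw [whisker_exchange, ← BraidedCategory.braiding_naturality_left]; monoidal
    _ = 𝟙 _ ⊗≫ ((β_ X Y).hom ▷ Y' ⊗≫ Y ◁ (β_ X Y').hom ⊗≫
          ((β_ Y Y').hom ≫ ε_ Y Y') ▷ X) ▷ X' ⊗≫ ((β_ X X').hom ≫ ε_ X X') := by
        rw [Iso.hom_inv_id, BraidedCategory.braiding_tensor_left_hom Y X Y']; monoidal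
    _ = _ := by
        rw [braiding_pairing_right]; monoidal

variable [RightRigidCategory C] [RibbonCategory C]

/-- The evaluation `X ⊗ X' ⟶ 𝟙_ C` obtained from an exact pairing by the braiding and the twist. -/
def revEv (X X' : C) [ExactPairing X X'] : X ⊗ X' ⟶ 𝟙_ C :=
  (twist X).hom ▷ X' ≫ (β_ X X').hom ≫ ε_ X X'

lemma revEv_naturality {X X' Y Y' : C} [ExactPairing X X'] [ExactPairing Y Y'] (f : X ⟶ Y)
    (g : Y' ⟶ X') (h : g ▷ X ≫ ε_ X X' = Y' ◁ f ≫ ε_ Y Y') :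
    f ▷ Y' ≫ revEv Y Y' = X ◁ g ≫ revEv X X' := by
  unfold revEv
  rw [← comp_whiskerRight_assoc, twist_naturality, comp_whiskerRight_assoc,
    BraidedCategory.braiding_naturality_left_assoc, ← h, whisker_exchange_assoc,
    BraidedCategory.braiding_naturality_right_assoc]

/-- The double braiding in the twist of X ⊗ Y is exactly what is needed to turn the braided
evaluation into nested ones. This is the source of the monoidality of the pivotal structure. -/
lemma revEv_tensor (X Y X' Y' : C) [ExactPairing X X'] [ExactPairing Y Y'] :
    revEv (X ⊗ Y) (Y' ⊗ X') = 𝟙 _ ⊗≫ X ◁ (revEv Y Y' ▷ X') ⊗≫ revEv X X' := by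
  have h : (twist (X ⊗ Y)).hom = ((twist X).hom ⊗ₘ (twist Y).hom) ≫
      (β_ X Y).hom ≫ (β_ Y X).hom := by
    rw [twist_tensor, BraidedCategory.braiding_naturality_assoc,
      BraidedCategory.braiding_naturality]
  unfold revEv
  rw [h, comp_whiskerRight_assoc, double_braiding_tensor_evaluation]
  calc _ = 𝟙 _ ⊗≫ X ◁ (((twist Y).hom ▷ Y' ≫ (β_ Y Y').hom ≫ ε_ Y Y') ▷ X') ⊗≫
     (twist X).hom ▷ X' ≫ (β_ X X').hom ≫ ε_ X X' := ?_
    _ = _ := by monoidal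
  calc _ = 𝟙 _ ⊗≫ X ◁ ((twist Y).hom ▷ Y') ▷ X' ⊗≫
     ((twist X).hom ▷ ((Y ⊗ Y') ⊗ X') ≫ X ◁ (((β_ Y Y').hom ≫ ε_ Y Y') ▷ X')) ⊗≫
      (β_ X X').hom ≫ ε_ X X' := by
        rw [tensorHom_def']; monoidal
    _ = _ := by
      rw [← whisker_exchange]; monoidal

/-- The tensor axiom on 1 ⊗ 1 says that the twist of the unit is idempotent; it is also invertible.
-/
lemma twist_unit : (twist (𝟙_ C)).hom = 𝟙 _ := by
  have h1 := twist_naturality (λ_ (𝟙_ C)).hom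
  rw [twist_tensor] at h1
  have h2 : (β_ (𝟙_ C) (𝟙_ C)).hom = 𝟙 _ := by
    rw [braiding_tensorUnit_right, ← unitors_equal, Iso.hom_inv_id]
  rw [h2, Category.id_comp, Category.id_comp, MonoidalCategory.tensorHom_def, Category.assoc,
    leftUnitor_naturality, unitors_equal, rightUnitor_naturality_assoc, cancel_epi] at h1
  rw [← cancel_epi (twist (𝟙_ C)).hom, ← h1, Category.comp_id]

lemma ribbonTrace_eq {X : C} (f : X ⟶ X) :
    ribbonTrace f = η_ X Xᘁ ≫ f ▷ Xᘁ ≫ revEv X Xᘁ := by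
  simp [ribbonTrace, revEv]

/-- The canonical isomorphism between two duals transports both the coevaluation and the reversed
evaluation. The trace may thus be computed with Γ as its own dual, with the dual of a module, or
with Y' ⊗ X' as the dual of X ⊗ Y. -/
lemma ribbonTrace_eq_of_exactPairing {X : C} (X' : C) [ExactPairing X X'] (f : X ⟶ X) :
    ribbonTrace f = η_ X X' ≫ f ▷ X' ≫ revEv X X' := by
  let i := rightDualIso (X := X) (Y₁ := X') (Y₂ := Xᘁ) inferInstance inferInstance
  have h1 : revEv X X' = X ◁ i.hom ≫ revEv X Xᘁ := by
    rw [← revEv_naturality (𝟙 X) i.hom (by simpa using rightDualIso_hom_ev _ _)]; simp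
  have h2 : η_ X X' ≫ X ◁ i.hom = η_ X Xᘁ := coev_rightDualIso_hom _ _
  rw [ribbonTrace_eq, h1, ← whisker_exchange_assoc, reassoc_of% h2]

/-- The morphism g is carried around the loop as its mate, first across the reversed evaluation and
then across the coevaluation. -/
lemma ribbonTrace_comm {X Y : C} (f : X ⟶ Y) (g : Y ⟶ X) :
    ribbonTrace (f ≫ g) = ribbonTrace (g ≫ f) := by
  rw [ribbonTrace_eq, ribbonTrace_eq, comp_whiskerRight_assoc,
    revEv_naturality g (rightAdjointMate g) (rightAdjointMate_comp_evaluation g),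
    ← whisker_exchange_assoc, coevaluation_comp_rightAdjointMate_assoc, comp_whiskerRight_assoc]

/-- The reversed exact pairing in a ribbon category. -/
@[reducible]
def revPairing (X X' : C) [ExactPairing X X'] : ExactPairing X' X :=
  letI := BraidedCategory.exactPairing_swap X X'
  exactPairingCongrRight (twist X)

/-- The isomorphism of an object of a ribbon category with its double dual. -/
def doubleDualIso (X X' X'' : C) [ExactPairing X X'] [ExactPairing X' X''] : X ≅ X'' :=
  rightDualIso (revPairing X X') inferInstance

lemma doubleDualIso_hom_ev (X X' X'' : C) [ExactPairing X X'] [ExactPairing X' X''] :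
    (doubleDualIso X X' X'').hom ▷ X' ≫ ε_ X' X'' = revEv X X' :=
  rightDualIso_hom_ev (revPairing X X') _

lemma coev_doubleDualIso_inv (X X' X'' : C) [ExactPairing X X'] [ExactPairing X' X''] :
    η_ X' X'' ≫ X' ◁ (doubleDualIso X X' X'').inv =
      (η_ X X' ≫ (β_ X' X).inv) ≫ X' ◁ (twist X).inv :=
  coev_rightDualIso_hom _ (revPairing X X')

lemma doubleDualIso_naturality {X X' X'' Y Y' Y'' : C} [ExactPairing X X'] [ExactPairing X' X'']
    [ExactPairing Y Y'] [ExactPairing Y' Y''] (f : X ⟶ Y) (f' : Y' ⟶ X') (f'' : X'' ⟶ Y'')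
    (h : f' ▷ X ≫ ε_ X X' = Y' ◁ f ≫ ε_ Y Y') (h' : f'' ▷ Y' ≫ ε_ Y' Y'' = X'' ◁ f' ≫ ε_ X' X'') :
    f ≫ (doubleDualIso Y Y' Y'').hom = (doubleDualIso X X' X'').hom ≫ f'' := by
  apply ev_ext (X := Y')
  rw [comp_whiskerRight_assoc, comp_whiskerRight_assoc, doubleDualIso_hom_ev,
    h', ← whisker_exchange_assoc, doubleDualIso_hom_ev, revEv_naturality f f' h]

/-- Naturality of the twist along the coevaluation, where the twist of the unit is trivial.
Compatibility of the twist with duals moves both twists to the strand X. This is what makes left and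
right closures of a strand agree. -/
lemma coev_twist (X X' : C) [ExactPairing X X'] :
    η_ X X' ≫ (twist X).hom ▷ X' ≫ (β_ X X').hom =
      η_ X X' ≫ (twist X).inv ▷ X' ≫ (β_ X' X).inv := by
  have h := twist_naturality (η_ X Xᘁ)
  rw [twist_unit, Category.id_comp, twist_tensor, ← BraidedCategory.braiding_naturality,
    ← BraidedCategory.braiding_naturality_assoc, twist_dual, tensorHom_def',
    Category.assoc, coevaluation_comp_rightAdjointMate_assoc] at h
  have h' : η_ X Xᘁ ≫ (twist X).hom ▷ Xᘁ ≫ (β_ X Xᘁ).hom =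
      η_ X Xᘁ ≫ (twist X).inv ▷ Xᘁ ≫ (β_ Xᘁ X).inv := by
    rw [← cancel_mono (β_ Xᘁ X).hom, ← cancel_mono ((twist X).hom ▷ Xᘁ)]
    simp only [Category.assoc, Iso.inv_hom_id_assoc, inv_hom_whiskerRight, Category.comp_id]
    rw [← BraidedCategory.braiding_naturality_right,
      ← BraidedCategory.braiding_naturality_left_assoc]
    exact h
  let i := rightDualIso (X := X) (Y₁ := Xᘁ) (Y₂ := X') inferInstance inferInstance
  have hi : η_ X X' = η_ X Xᘁ ≫ X ◁ i.hom := (coev_rightDualIso_hom _ _).symm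
  rw [hi]
  simp only [Category.assoc]
  rw [whisker_exchange_assoc, whisker_exchange_assoc, BraidedCategory.braiding_naturality_right,
    BraidedCategory.braiding_inv_naturality_right, reassoc_of% h']

lemma leftTrace_doubleDual {X : C} (X' X'' : C) [ExactPairing X X'] [ExactPairing X' X'']
    (f : X ⟶ X) :
    η_ X' X'' ≫ X' ◁ ((doubleDualIso X X' X'').inv ≫ f) ≫ ε_ X X' = ribbonTrace f := by
  rw [MonoidalCategory.whiskerLeft_comp_assoc, reassoc_of% coev_doubleDualIso_inv,
    ← BraidedCategory.braiding_inv_naturality_left_assoc, ← reassoc_of% coev_twist,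
    ← BraidedCategory.braiding_naturality_left_assoc, ribbonTrace_eq_of_exactPairing X', revEv,
    ← comp_whiskerRight_assoc, ← twist_naturality, comp_whiskerRight_assoc]

lemma ribbonTrace_id_tensor (X Y : C) : ribbonTrace (𝟙 (X ⊗ Y)) =
    η_ X Xᘁ ≫ X ◁ ((λ_ Xᘁ).inv ≫ ribbonTrace (𝟙 Y) ▷ Xᘁ ≫ (λ_ Xᘁ).hom) ≫ revEv X Xᘁ := by
  rw [ribbonTrace_eq_of_exactPairing (Yᘁ ⊗ Xᘁ), revEv_tensor, ExactPairing.tensor_coevaluation,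
    ribbonTrace_eq]
  simp only [id_whiskerRight, Category.id_comp]
  monoidal

end Ribbon

/-- A counit and a copairing that make a monoid a Frobenius algebra, normalized such that
`copairing ≫ μ = η`. -/
structure SeparableFrobenius {C : Type u} [Category.{v} C] [MonoidalCategory C] (Γ : C)
    [MonObj Γ] where
  counit : Γ ⟶ 𝟙_ C
  copairing : 𝟙_ C ⟶ Γ ⊗ Γ
  central : (ρ_ Γ).inv ≫ Γ ◁ copairing ≫ (α_ _ _ _).inv ≫ μ[Γ] ▷ Γ =
    (λ_ Γ).inv ≫ copairing ▷ Γ ≫ (α_ _ _ _).hom ≫ Γ ◁ μ[Γ]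
  copairing_mul : copairing ≫ μ[Γ] = η[Γ]
  counit_left : copairing ≫ counit ▷ Γ ≫ (λ_ Γ).hom = η[Γ]
  counit_right : copairing ≫ Γ ◁ counit ≫ (ρ_ Γ).hom = η[Γ]

/-! ### Normalized Frobenius algebras and their coaction on modules -/

namespace SeparableFrobenius

lemma copairing_braiding {C : Type u} [Category.{v} C] [MonoidalCategory C] [BraidedCategory C]
    {A B : C} (κ : 𝟙_ C ⟶ A ⊗ B) (Z : C) :
    κ ▷ Z ⊗≫ A ◁ (β_ B Z).hom = 𝟙 _ ⊗≫ Z ◁ κ ⊗≫ (β_ A Z).inv ▷ B ⊗≫ 𝟙 _ := by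
  have h := BraidedCategory.braiding_naturality_left κ Z
  rw [BraidedCategory.braiding_tensor_left_hom, braiding_tensorUnit_left] at h
  calc _ = (κ ▷ Z ≫ ((α_ A B Z).hom ≫ A ◁ (β_ B Z).hom ≫ (α_ A Z B).inv ≫ (β_ A Z).hom ▷ B ≫
          (α_ Z A B).hom)) ⊗≫ (β_ A Z).inv ▷ B ⊗≫ 𝟙 _ := by
        calc _ = κ ▷ Z ⊗≫ A ◁ (β_ B Z).hom ⊗≫ ((β_ A Z).hom ≫ (β_ A Z).inv) ▷ B ⊗≫ 𝟙 _ := by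
              rw [Iso.hom_inv_id]; monoidal
          _ = _ := by monoidal
    _ = _ := by rw [h]; monoidal

section Module

variable {C : Type u} [Category.{v} C] [MonoidalCategory C] {Γ : C} [MonObj Γ]
  (S : SeparableFrobenius Γ)

lemma central' : Γ ◁ S.copairing ⊗≫ μ[Γ] ▷ Γ = 𝟙 _ ⊗≫ S.copairing ▷ Γ ⊗≫ Γ ◁ μ[Γ] := by
  have h := S.central
  calc _ = (ρ_ Γ).hom ≫ ((ρ_ Γ).inv ≫ Γ ◁ S.copairing ≫ (α_ _ _ _).inv ≫ μ[Γ] ▷ Γ) := by monoidal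
    _ = _ := by rw [h]; monoidal

/-- The coaction of the copairing on a module. -/
def coact (M : Mod C Γ) : M.X ⟶ Γ ⊗ M.X :=
  (λ_ M.X).inv ≫ S.copairing ▷ M.X ≫ (α_ _ _ _).hom ≫ Γ ◁ M.act

/-- Centrality of the copairing makes m ↦ Σ eᵢ ⊗ eⁱm a module map to the free module on `M.X`. By
`coact_act` it is a section of the action, which is the separability of Γ. -/
lemma act_coact (M : Mod C Γ) :
    M.act ≫ S.coact M = Γ ◁ S.coact M ≫ (α_ _ _ _).inv ≫ μ[Γ] ▷ M.X := by
  unfold coact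
  calc _ = 𝟙 _ ⊗≫ (𝟙_ C ◁ M.act ≫ S.copairing ▷ M.X) ⊗≫ Γ ◁ M.act := by monoidal
    _ = 𝟙 _ ⊗≫ S.copairing ▷ (Γ ⊗ M.X) ⊗≫ Γ ◁ ((α_ Γ Γ M.X).hom ≫ Γ ◁ M.act ≫ M.act) := by
      rw [whisker_exchange]; monoidal
    _ = 𝟙 _ ⊗≫ (𝟙 (Γ ⊗ 𝟙_ C) ⊗≫ S.copairing ▷ Γ ⊗≫ Γ ◁ μ[Γ]) ▷ M.X ⊗≫ Γ ◁ M.act := by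
      rw [← Mod.mul_act]; monoidal
    _ = 𝟙 _ ⊗≫ Γ ◁ S.copairing ▷ M.X ⊗≫ (μ[Γ] ▷ (Γ ⊗ M.X) ≫ Γ ◁ M.act) := by
      rw [← central']; monoidal
    _ = _ := by rw [← whisker_exchange]; monoidal

lemma coact_act (M : Mod C Γ) : S.coact M ≫ M.act = 𝟙 _ := by
  unfold coact
  simp only [Category.assoc]
  rw [← Mod.mul_act, ← comp_whiskerRight_assoc, S.copairing_mul, Mod.one_act, Iso.inv_hom_id]

lemma coact_counit (M : Mod C Γ) : S.coact M ≫ S.counit ▷ M.X ≫ (λ_ _).hom = 𝟙 _ := by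
  unfold coact
  calc _ = 𝟙 _ ⊗≫ S.copairing ▷ M.X ⊗≫ (Γ ◁ M.act ≫ S.counit ▷ M.X) ⊗≫ 𝟙 _ := by monoidal
    _ = 𝟙 _ ⊗≫ (S.copairing ≫ S.counit ▷ Γ ≫ (λ_ Γ).hom) ▷ M.X ≫ M.act := by
      rw [whisker_exchange]; monoidal
    _ = _ := by rw [S.counit_left, Mod.one_act]; monoidal

lemma coact_map {M N : Mod C Γ} (f : M ⟶ N) :
    S.coact M ≫ Γ ◁ f.hom = f.hom ≫ S.coact N := by
  unfold coact
  calc _ = 𝟙 _ ⊗≫ S.copairing ▷ M.X ⊗≫ Γ ◁ (M.act ≫ f.hom) := by monoidal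
    _ = 𝟙 _ ⊗≫ (S.copairing ▷ M.X ≫ (Γ ⊗ Γ) ◁ f.hom) ⊗≫ Γ ◁ N.act := by
      rw [Mod.act_hom]; monoidal
    _ = _ := by rw [← whisker_exchange]; monoidal

lemma coact_linear {M : Mod C Γ} (f : M.X ⟶ Γ) (hf : M.act ≫ f = Γ ◁ f ≫ μ[Γ]) :
    S.coact M ≫ Γ ◁ f = f ≫ (λ_ Γ).inv ≫ S.copairing ▷ Γ ≫ (α_ _ _ _).hom ≫ Γ ◁ μ[Γ] := by
  unfold coact
  calc _ = 𝟙 _ ⊗≫ S.copairing ▷ M.X ⊗≫ Γ ◁ (M.act ≫ f) := by monoidal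
    _ = 𝟙 _ ⊗≫ (S.copairing ▷ M.X ≫ (Γ ⊗ Γ) ◁ f) ⊗≫ Γ ◁ μ[Γ] := by
      rw [hf]; monoidal
    _ = _ := by rw [← whisker_exchange]; monoidal

/-- With κ = Σ eᵢ ⊗ eⁱ, linearity and centrality give Σ eᵢ counit(f(eⁱm)) = Σ eᵢ counit(eⁱf(m)) = Σ
f(m)eᵢ counit(eⁱ) = f(m). So a linear map to Γ is determined by its composite with the counit. -/
lemma linear_eq {M : Mod C Γ} (f : M.X ⟶ Γ) (hf : M.act ≫ f = Γ ◁ f ≫ μ[Γ]) :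
    f = S.coact M ≫ Γ ◁ (f ≫ S.counit) ≫ (ρ_ Γ).hom := by
  rw [MonoidalCategory.whiskerLeft_comp, Category.assoc, reassoc_of% S.coact_linear f hf,
    ← reassoc_of% S.central]
  calc _ = f ≫ (𝟙 _ ⊗≫ Γ ◁ (S.copairing ≫ Γ ◁ S.counit ≫ (ρ_ Γ).hom) ≫ μ[Γ]) := by
        rw [S.counit_right]; simp [monoidalComp]
    _ = f ≫ (𝟙 _ ⊗≫ Γ ◁ S.copairing ⊗≫ (μ[Γ] ▷ Γ ≫ Γ ◁ S.counit) ⊗≫ 𝟙 _) := by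
      rw [← whisker_exchange]; monoidal
    _ = _ := by monoidal

lemma lift_linear {M : Mod C Γ} (g : M.X ⟶ 𝟙_ C) :
    M.act ≫ S.coact M ≫ Γ ◁ g ≫ (ρ_ Γ).hom =
      Γ ◁ (S.coact M ≫ Γ ◁ g ≫ (ρ_ Γ).hom) ≫ μ[Γ] := by
  rw [reassoc_of% S.act_coact M]
  calc _ = Γ ◁ S.coact M ⊗≫ (μ[Γ] ▷ M.X ≫ Γ ◁ g) ⊗≫ 𝟙 _ := by monoidal
    _ = _ := by rw [← whisker_exchange]; monoidal

lemma coact_whiskerLeft_counit {M : Mod C Γ} (g : M.X ⟶ 𝟙_ C) :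
    (S.coact M ≫ Γ ◁ g ≫ (ρ_ Γ).hom) ≫ S.counit = g := by
  calc _ = S.coact M ≫ (Γ ◁ g ≫ S.counit ▷ 𝟙_ C) ⊗≫ 𝟙 _ := by monoidal
    _ = (S.coact M ≫ S.counit ▷ M.X ≫ (λ_ _).hom) ≫ g := by rw [whisker_exchange]; monoidal
    _ = g := by rw [coact_counit, Category.id_comp]

/-- The pairing of a Frobenius algebra with itself. -/
@[reducible]
def selfPairing : ExactPairing Γ Γ where
  coevaluation' := S.copairing
  evaluation' := μ[Γ] ≫ S.counit
  coevaluation_evaluation' := by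
    calc _ = (Γ ◁ S.copairing ⊗≫ μ[Γ] ▷ Γ) ≫ S.counit ▷ Γ := by monoidal
      _ = 𝟙 _ ⊗≫ S.copairing ▷ Γ ⊗≫ (Γ ◁ μ[Γ] ≫ S.counit ▷ Γ) := by rw [central']; monoidal
      _ = 𝟙 _ ⊗≫ (S.copairing ≫ S.counit ▷ Γ ≫ (λ_ Γ).hom) ▷ Γ ≫ μ[Γ] ≫ (λ_ Γ).inv := by
        rw [whisker_exchange]; monoidal
      _ = _ := by rw [S.counit_left]; simp [monoidalComp]
  evaluation_coevaluation' := by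
    calc _ = 𝟙 _ ⊗≫ (𝟙 (Γ ⊗ 𝟙_ C) ⊗≫ S.copairing ▷ Γ ⊗≫ Γ ◁ μ[Γ]) ≫ Γ ◁ S.counit := by
          monoidal
      _ = 𝟙 _ ⊗≫ Γ ◁ S.copairing ⊗≫ (μ[Γ] ▷ Γ ≫ Γ ◁ S.counit) := by rw [← central']; monoidal
      _ = 𝟙 _ ⊗≫ Γ ◁ (S.copairing ≫ Γ ◁ S.counit ≫ (ρ_ Γ).hom) ≫ μ[Γ] ≫ (ρ_ Γ).inv := by
        rw [← whisker_exchange]; monoidal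
      _ = _ := by rw [S.counit_right]; simp [monoidalComp]

end Module

end SeparableFrobenius

/-! ### Morphisms from and to the unit module -/

namespace Mod

section Extend

variable {C : Type u} [Category.{v} C] [MonoidalCategory C] {Γ : C} [MonObj Γ]

/-- The unit module is free on the unit object: this and the next two lemmas identify linear maps Γ
⟶ M with elements 1 ⟶ M. -/
lemma extend_linear {M : Mod C Γ} (x : 𝟙_ C ⟶ M.X) :
    μ[Γ] ≫ (ρ_ Γ).inv ≫ Γ ◁ x ≫ M.act = Γ ◁ ((ρ_ Γ).inv ≫ Γ ◁ x ≫ M.act) ≫ M.act := by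
  calc _ = 𝟙 _ ⊗≫ (μ[Γ] ▷ 𝟙_ C ≫ Γ ◁ x) ≫ M.act := by monoidal
    _ = 𝟙 _ ⊗≫ (Γ ⊗ Γ) ◁ x ≫ μ[Γ] ▷ M.X ≫ M.act := by rw [← whisker_exchange]; monoidal
    _ = _ := by rw [mul_act]; monoidal

lemma one_extend {M : Mod C Γ} (x : 𝟙_ C ⟶ M.X) : η[Γ] ≫ (ρ_ Γ).inv ≫ Γ ◁ x ≫ M.act = x := by
  calc _ = 𝟙 _ ⊗≫ (η[Γ] ▷ 𝟙_ C ≫ Γ ◁ x) ≫ M.act := by monoidal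
    _ = x := by rw [← whisker_exchange, Category.assoc, one_act]; monoidal

lemma linear_eq_extend {M : Mod C Γ} (f : Γ ⟶ M.X) (hf : μ[Γ] ≫ f = Γ ◁ f ≫ M.act) :
    f = (ρ_ Γ).inv ≫ Γ ◁ (η[Γ] ≫ f) ≫ M.act := by
  rw [MonoidalCategory.whiskerLeft_comp, Category.assoc, ← hf, MonObj.mul_one_assoc,
    Iso.inv_hom_id_assoc]

end Extend

section Unit

variable {C : Type u} [Category.{v} C] [MonoidalCategory C] [HasCoequalizers C]
  [∀ X : C, PreservesColimitsOfSize.{0, 0} (tensorLeft X)]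
  [∀ X : C, PreservesColimitsOfSize.{0, 0} (tensorRight X)]
  [BraidedCategory C] {Γ : C} [MonObj Γ] [IsCommMonObj Γ]

variable (Γ) in
/-- The unit of `Γ`, as a morphism to the underlying object of the unit module. -/
noncomputable def one : 𝟙_ C ⟶ (𝟙_ (Mod C Γ)).X := η[Γ]

/-- The module morphism from the unit module that corresponds to a morphism from the unit
object. -/
noncomputable def extend {M : Mod C Γ} (x : 𝟙_ C ⟶ M.X) : 𝟙_ (Mod C Γ) ⟶ M :=
  homOfAct ((ρ_ Γ).inv ≫ Γ ◁ x ≫ M.act) (extend_linear x)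

lemma one_comp_extend {M : Mod C Γ} (x : 𝟙_ C ⟶ M.X) : one Γ ≫ (extend x).hom = x :=
  one_extend x

lemma extend_ext {M : Mod C Γ} {f g : 𝟙_ (Mod C Γ) ⟶ M} (h : one Γ ≫ f.hom = one Γ ≫ g.hom) :
    f = g :=
  Mod.hom_ext _ _ ((linear_eq_extend (Γ := Γ) f.hom (act_hom f)).trans
    ((congrArg (fun t => (ρ_ Γ).inv ≫ Γ ◁ t ≫ M.act) h).trans
      (linear_eq_extend (Γ := Γ) g.hom (act_hom g)).symm))

end Unit

end Mod

namespace SeparableFrobenius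

section Unit

variable {C : Type u} [Category.{v} C] [MonoidalCategory C] [HasCoequalizers C]
  [∀ X : C, PreservesColimitsOfSize.{0, 0} (tensorLeft X)]
  [∀ X : C, PreservesColimitsOfSize.{0, 0} (tensorRight X)]
  [BraidedCategory C] {Γ : C} [MonObj Γ] [IsCommMonObj Γ] (S : SeparableFrobenius Γ)

/-- The counit, as a morphism from the underlying object of the unit module. -/
noncomputable def counitMod : (𝟙_ (Mod C Γ)).X ⟶ 𝟙_ C := S.counit

/-- The module morphism to the unit module that corresponds to a morphism to the unit object. -/
noncomputable def lift {M : Mod C Γ} (g : M.X ⟶ 𝟙_ C) : M ⟶ 𝟙_ (Mod C Γ) :=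
  Mod.homOfAct (S.coact M ≫ Γ ◁ g ≫ (ρ_ Γ).hom) (S.lift_linear g)

lemma lift_counit {M : Mod C Γ} (g : M.X ⟶ 𝟙_ C) : (S.lift g).hom ≫ S.counitMod = g :=
  S.coact_whiskerLeft_counit g

lemma hom_eq {M : Mod C Γ} (f : M ⟶ 𝟙_ (Mod C Γ)) :
    f.hom = S.coact M ≫ Γ ◁ (f.hom ≫ S.counitMod) ≫ (ρ_ Γ).hom :=
  S.linear_eq f.hom (Mod.act_hom f)

lemma lift_ext {M : Mod C Γ} {f g : M ⟶ 𝟙_ (Mod C Γ)}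
    (h : f.hom ≫ S.counitMod = g.hom ≫ S.counitMod) : f = g :=
  Mod.hom_ext _ _ ((S.hom_eq f).trans
    ((congrArg (fun t => S.coact M ≫ Γ ◁ t ≫ (ρ_ Γ).hom) h).trans (S.hom_eq g).symm))

end Unit

/-! ### Balanced pairings in `C` and pairings of modules -/

section Balanced

variable {C : Type u} [Category.{v} C] [MonoidalCategory C] [BraidedCategory C] {Γ : C} [MonObj Γ]
  (S : SeparableFrobenius Γ)

/-- A balanced pairing lifts to a Γ-valued one by the coaction on either factor; balancedness moves
the factor eⁱ of κ from M to N. -/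
lemma coact_balanced {M N : Mod C Γ} (b : M.X ⊗ N.X ⟶ 𝟙_ C)
    (hb : M.ract ▷ N.X ≫ b = (α_ _ _ _).hom ≫ M.X ◁ N.act ≫ b) :
    S.coact M ▷ N.X ≫ (α_ _ _ _).hom ≫ Γ ◁ b ≫ (ρ_ Γ).hom =
      M.X ◁ S.coact N ≫ (α_ _ _ _).inv ≫ (β_ Γ M.X).inv ▷ N.X ≫ (α_ _ _ _).hom ≫
        Γ ◁ b ≫ (ρ_ Γ).hom := by
  have h : M.act = (β_ Γ M.X).hom ≫ M.ract := by simp [Mod.ract]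
  unfold coact
  rw [h]
  calc _ = 𝟙 _ ⊗≫ (S.copairing ▷ M.X ⊗≫ Γ ◁ (β_ Γ M.X).hom) ▷ N.X ⊗≫
        Γ ◁ (M.ract ▷ N.X ≫ b) ⊗≫ 𝟙 _ := by monoidal
    _ = 𝟙 _ ⊗≫ (M.X ◁ S.copairing) ▷ N.X ⊗≫ ((β_ Γ M.X).inv ▷ (Γ ⊗ N.X) ≫
        (Γ ⊗ M.X) ◁ N.act) ⊗≫ Γ ◁ b ⊗≫ 𝟙 _ := by
      rw [hb, copairing_braiding]; monoidal
    _ = _ := by rw [← whisker_exchange]; monoidal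

/-- The projector of `M.X ⊗ N.X` whose image is the tensor product of modules. -/
def projector (M N : Mod C Γ) : M.X ⊗ N.X ⟶ M.X ⊗ N.X :=
  M.X ◁ S.coact N ≫ (α_ _ _ _).inv ≫ M.ract ▷ N.X

/-- The inner pairing takes values in Γ, which acts on P'. Balancedness of the outer pairing moves
this action to P, where it combines with the coaction on Q to give the projector. -/
lemma nested_balanced {P Q Q' P' : Mod C Γ} (b : Q.X ⊗ Q'.X ⟶ 𝟙_ C) (b' : P.X ⊗ P'.X ⟶ 𝟙_ C)
    (hb : P.ract ▷ P'.X ≫ b' = (α_ _ _ _).hom ≫ P.X ◁ P'.act ≫ b') :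
    (α_ P.X Q.X (Q'.X ⊗ P'.X)).hom ≫ P.X ◁ ((α_ Q.X Q'.X P'.X).inv ≫
      (S.coact Q ▷ Q'.X ≫ (α_ _ _ _).hom ≫ Γ ◁ b ≫ (ρ_ Γ).hom) ▷ P'.X ≫ P'.act) ≫ b' =
    S.projector P Q ▷ (Q'.X ⊗ P'.X) ≫ (𝟙 _ ⊗≫ P.X ◁ (b ▷ P'.X) ⊗≫ b') := by
  unfold projector
  calc _ = 𝟙 _ ⊗≫ P.X ◁ S.coact Q ▷ (Q'.X ⊗ P'.X) ⊗≫ P.X ◁ Γ ◁ b ▷ P'.X ⊗≫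
      ((α_ _ _ _).hom ≫ P.X ◁ P'.act ≫ b') := by monoidal
    _ = 𝟙 _ ⊗≫ P.X ◁ S.coact Q ▷ (Q'.X ⊗ P'.X) ⊗≫ ((P.X ⊗ Γ) ◁ (b ▷ P'.X) ≫
      P.ract ▷ (𝟙_ C ⊗ P'.X)) ⊗≫ b' := by rw [← hb]; monoidal
    _ = _ := by rw [whisker_exchange]; monoidal

end Balanced

section Tensor

open CategoryTheory.Mod

variable {C : Type u} [Category.{v} C] [MonoidalCategory C] [HasCoequalizers C]
  [∀ X : C, PreservesColimitsOfSize.{0, 0} (tensorLeft X)]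
  [∀ X : C, PreservesColimitsOfSize.{0, 0} (tensorRight X)]
  [BraidedCategory C] {Γ : C} [MonObj Γ] [IsCommMonObj Γ] (S : SeparableFrobenius Γ)

lemma proj_coact (M N : Mod C Γ) : proj M N ≫ S.coact (M ⊗ N) =
    S.coact M ▷ N.X ≫ (α_ _ _ _).hom ≫ Γ ◁ proj M N := by
  unfold coact
  calc _ = 𝟙 _ ⊗≫ (𝟙_ C ◁ proj M N ≫ S.copairing ▷ (M ⊗ N).X) ⊗≫ Γ ◁ (M ⊗ N).act := by monoidal
    _ = 𝟙 _ ⊗≫ S.copairing ▷ (M.X ⊗ N.X) ⊗≫ Γ ◁ (Γ ◁ proj M N ≫ (M ⊗ N).act) := by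
      rw [whisker_exchange]; monoidal
    _ = _ := by rw [proj_act]; monoidal

/-- The pairing in `C` that underlies a pairing of modules. -/
noncomputable def pairing {M N : Mod C Γ} (B : M ⊗ N ⟶ 𝟙_ (Mod C Γ)) : M.X ⊗ N.X ⟶ 𝟙_ C :=
  proj M N ≫ B.hom ≫ S.counitMod

lemma pairing_balanced {M N : Mod C Γ} (B : M ⊗ N ⟶ 𝟙_ (Mod C Γ)) :
    M.ract ▷ N.X ≫ S.pairing B = (α_ _ _ _).hom ≫ M.X ◁ N.act ≫ S.pairing B := by
  unfold pairing
  rw [reassoc_of% proj_condition M N]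

lemma pairing_ext {M N : Mod C Γ} {B B' : M ⊗ N ⟶ 𝟙_ (Mod C Γ)} (h : S.pairing B = S.pairing B') :
    B = B' :=
  S.lift_ext (tensor_hom_ext h)

/-- The pairing of modules given by a balanced pairing in `C`. -/
noncomputable def ofPairing {M N : Mod C Γ} (b : M.X ⊗ N.X ⟶ 𝟙_ C)
    (hb : M.ract ▷ N.X ≫ b = (α_ _ _ _).hom ≫ M.X ◁ N.act ≫ b) : M ⊗ N ⟶ 𝟙_ (Mod C Γ) :=
  S.lift (desc b hb)

lemma pairing_ofPairing {M N : Mod C Γ} (b : M.X ⊗ N.X ⟶ 𝟙_ C)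
    (hb : M.ract ▷ N.X ≫ b = (α_ _ _ _).hom ≫ M.X ◁ N.act ≫ b) :
    S.pairing (S.ofPairing b hb) = b := by
  rw [pairing, ofPairing, lift_counit, proj_desc]

/-- The morphism to `Γ` that underlies a morphism to the unit module. -/
def toUnit {M : Mod C Γ} (f : M ⟶ 𝟙_ (Mod C Γ)) : M.X ⟶ Γ := f.hom

lemma proj_whiskerRight_leftUnitor {M : Mod C Γ} (f : M ⟶ 𝟙_ (Mod C Γ)) (N : Mod C Γ) :
    proj M N ≫ (f ▷ N).hom ≫ (λ_ N).hom.hom = toUnit f ▷ N.X ≫ N.act := by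
  rw [reassoc_of% proj_whiskerRight]
  exact congrArg (fun t => f.hom ▷ N.X ≫ t) (proj_leftUnitor N)

lemma proj_whiskerLeft_rightUnitor {M : Mod C Γ} (f : M ⟶ 𝟙_ (Mod C Γ)) (N : Mod C Γ) :
    proj N M ≫ (N ◁ f).hom ≫ (ρ_ N).hom.hom = N.X ◁ toUnit f ≫ N.ract := by
  rw [reassoc_of% proj_whiskerLeft]
  exact congrArg (fun t => N.X ◁ f.hom ≫ t) (proj_rightUnitor N)

lemma proj_pairing {M N : Mod C Γ} (B : M ⊗ N ⟶ 𝟙_ (Mod C Γ)) : proj M N ≫ toUnit B =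
    S.coact M ▷ N.X ≫ (α_ _ _ _).hom ≫ Γ ◁ S.pairing B ≫ (ρ_ Γ).hom := by
  have h : toUnit B = S.coact (M ⊗ N) ≫ Γ ◁ (B.hom ≫ S.counitMod) ≫ (ρ_ Γ).hom := S.hom_eq B
  rw [h, reassoc_of% S.proj_coact M N, pairing,
    MonoidalCategory.whiskerLeft_comp Γ (proj M N), Category.assoc]

lemma proj_pairing' {M N : Mod C Γ} (B : M ⊗ N ⟶ 𝟙_ (Mod C Γ)) : proj M N ≫ toUnit B =
    M.X ◁ S.coact N ≫ (α_ _ _ _).inv ≫ (β_ Γ M.X).inv ▷ N.X ≫ (α_ _ _ _).hom ≫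
      Γ ◁ S.pairing B ≫ (ρ_ Γ).hom := by
  have hb := S.pairing_balanced B
  rw [proj_pairing]
  exact S.coact_balanced (S.pairing B) hb

/-- In the quotient the action on M can be moved to N, where it cancels the coaction. -/
lemma projector_proj (M N : Mod C Γ) : S.projector M N ≫ proj M N = proj M N := by
  unfold projector
  simp only [Category.assoc]
  rw [proj_condition, Iso.inv_hom_id_assoc, ← MonoidalCategory.whiskerLeft_comp_assoc, coact_act]
  simp

lemma nested_eq {D : Type*} [Category* D] [MonoidalCategory D] {P Q Q' P' Z : D}
    (B : Q ⊗ Q' ⟶ 𝟙_ D) (B' : P ⊗ P' ⟶ Z) :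
    (𝟙 ((P ⊗ Q) ⊗ Q' ⊗ P') ⊗≫ P ◁ (B ▷ P') ⊗≫ B') =
      (α_ P Q (Q' ⊗ P')).hom ≫ P ◁ ((α_ Q Q' P').inv ≫ B ▷ P' ≫ (λ_ P').hom) ≫ B' := by
  monoidal

/-- Nesting pairings of modules is not quite nesting pairings in `C`: the inner module pairing has
values in Γ rather than in 1, and the discrepancy is the projector. -/
lemma proj_nested {P Q Q' P' : Mod C Γ} (B : Q ⊗ Q' ⟶ 𝟙_ (Mod C Γ))
    (B' : P ⊗ P' ⟶ 𝟙_ (Mod C Γ)) :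
    (proj P Q ⊗ₘ proj Q' P') ≫ S.pairing (M := P ⊗ Q) (N := Q' ⊗ P')
        (𝟙 _ ⊗≫ P ◁ (B ▷ P') ⊗≫ B') =
      S.projector P Q ▷ (Q'.X ⊗ P'.X) ≫
        (𝟙 _ ⊗≫ P.X ◁ (S.pairing B ▷ P'.X) ⊗≫ S.pairing B') := by
  have e : (𝟙 ((P ⊗ Q) ⊗ Q' ⊗ P') ⊗≫ P ◁ (B ▷ P') ⊗≫ B') =
      (α_ P Q (Q' ⊗ P')).hom ≫ P ◁ ((α_ Q Q' P').inv ≫ B ▷ P' ≫ (λ_ P').hom) ≫ B' := nested_eq _ _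
  have h1 : Q.X ◁ proj Q' P' ≫ proj Q (Q' ⊗ P') ≫
      ((α_ Q Q' P').inv ≫ B ▷ P' ≫ (λ_ P').hom).hom =
      (α_ _ _ _).inv ≫ (proj Q Q' ≫ toUnit B) ▷ P'.X ≫ P'.act := by
    rw [comp_hom', comp_hom', reassoc_of% proj_associator_inv, proj_whiskerRight_leftUnitor,
      comp_whiskerRight_assoc]
  have hb := S.pairing_balanced B'
  rw [e, pairing, comp_hom', comp_hom', tensorHom_def']
  simp only [Category.assoc]
  rw [reassoc_of% proj_associator, reassoc_of% proj_whiskerLeft,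
    associator_naturality_right_assoc, ← MonoidalCategory.whiskerLeft_comp_assoc,
    ← MonoidalCategory.whiskerLeft_comp_assoc, Category.assoc, h1, proj_pairing, ← pairing]
  exact S.nested_balanced _ _ hb

end Tensor

end SeparableFrobenius

/-! ### Dual modules and rigidity -/

lemma zigzag_ev {D : Type u} [Category.{v} D] [MonoidalCategory D] {M M' : D}
    (c : 𝟙_ D ⟶ M ⊗ M') (e : M' ⊗ M ⟶ 𝟙_ D)
    (h : c ▷ M ≫ (α_ _ _ _).hom ≫ M ◁ e = (λ_ M).hom ≫ (ρ_ M).inv) :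
    ((ρ_ M').inv ≫ M' ◁ c ≫ (α_ _ _ _).inv ≫ e ▷ M' ≫ (λ_ M').hom) ▷ M ≫ e = e := by
  calc _ = 𝟙 _ ⊗≫ M' ◁ c ▷ M ⊗≫ (e ▷ (M' ⊗ M) ≫ 𝟙_ D ◁ e) ⊗≫ 𝟙 _ := by monoidal
    _ = 𝟙 _ ⊗≫ M' ◁ (c ▷ M ≫ (α_ _ _ _).hom ≫ M ◁ e) ⊗≫ e := by
      rw [← whisker_exchange]; monoidal
    _ = _ := by rw [h]; monoidal

/-- An exact pairing from one of the two triangle equalities, when the evaluation is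
nondegenerate. -/
@[reducible]
def exactPairingOfNondegenerate {D : Type u} [Category.{v} D] [MonoidalCategory D] {M M' : D}
    (c : 𝟙_ D ⟶ M ⊗ M') (e : M' ⊗ M ⟶ 𝟙_ D)
    (h : c ▷ M ≫ (α_ _ _ _).hom ≫ M ◁ e = (λ_ M).hom ≫ (ρ_ M).inv)
    (he : ∀ q : M' ⟶ M', q ▷ M ≫ e = e → q = 𝟙 _) : ExactPairing M M' where
  coevaluation' := c
  evaluation' := e
  evaluation_coevaluation' := h
  coevaluation_evaluation' := by
    -- The other snake is an endomorphism of M' that preserves the evaluation, so nondegeneracy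
    -- makes it the identity.
    have := he _ (zigzag_ev c e h)
    rw [Iso.inv_comp_eq, Category.comp_id] at this
    rw [← this]
    simp

namespace Mod

section Dual

variable {C : Type u} [Category.{v} C] [MonoidalCategory C] [BraidedCategory C]
  {Γ : C} [MonObj Γ]

/-- Transposing an action reverses the order of multiplication; commutativity of Γ restores it, so
the transpose is again a left action. -/
lemma pairing_mul_act [IsCommMonObj Γ] {X Y : C} (a : Γ ⊗ X ⟶ X) (d : Γ ⊗ Y ⟶ Y)
    (e : Y ⊗ X ⟶ 𝟙_ C)
    (ha : μ[Γ] ▷ X ≫ a = (α_ _ _ _).hom ≫ Γ ◁ a ≫ a)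
    (hd : d ▷ X ≫ e = (β_ Γ Y).hom ▷ X ≫ (α_ _ _ _).hom ≫ Y ◁ a ≫ e) :
    (μ[Γ] ▷ Y ≫ d) ▷ X ≫ e = ((α_ _ _ _).hom ≫ Γ ◁ d ≫ d) ▷ X ≫ e := by
  symm
  simp only [comp_whiskerRight_assoc, hd]
  calc _ = 𝟙 _ ⊗≫ (Γ ◁ d ≫ (β_ Γ Y).hom) ▷ X ⊗≫ Y ◁ a ≫ e := by monoidal
    _ = 𝟙 _ ⊗≫ (β_ Γ (Γ ⊗ Y)).hom ▷ X ⊗≫ (d ▷ (Γ ⊗ X) ≫ Y ◁ a) ≫ e := by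
      rw [BraidedCategory.braiding_naturality_right]; monoidal
    _ = 𝟙 _ ⊗≫ (β_ Γ (Γ ⊗ Y)).hom ▷ X ⊗≫ (Γ ⊗ Y) ◁ a ≫ d ▷ X ≫ e := by
      rw [← whisker_exchange]; monoidal
    _ = 𝟙 _ ⊗≫ ((β_ Γ Γ).hom ▷ Y ⊗≫ Γ ◁ (β_ Γ Y).hom) ▷ X ⊗≫ ((Γ ⊗ Y) ◁ a ≫
          (β_ Γ Y).hom ▷ X) ⊗≫ Y ◁ a ≫ e := by
      rw [hd, BraidedCategory.braiding_tensor_right_hom]; monoidal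
    _ = 𝟙 _ ⊗≫ ((β_ Γ Γ).hom ▷ Y ≫ ((α_ _ _ _).hom ≫ Γ ◁ (β_ Γ Y).hom ≫ (α_ _ _ _).inv ≫
          (β_ Γ Y).hom ▷ Γ ≫ (α_ _ _ _).hom)) ▷ X ⊗≫
          Y ◁ ((α_ _ _ _).hom ≫ Γ ◁ a ≫ a) ≫ e := by
      rw [whisker_exchange]; monoidal
    _ = 𝟙 _ ⊗≫ (β_ (Γ ⊗ Γ) Y).hom ▷ X ⊗≫ Y ◁ ((β_ Γ Γ).hom ≫ μ[Γ]) ▷ X ⊗≫ Y ◁ a ≫ e := by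
      rw [← BraidedCategory.braiding_tensor_left_hom, BraidedCategory.braiding_naturality_left,
        ← ha]
      monoidal
    _ = 𝟙 _ ⊗≫ ((β_ (Γ ⊗ Γ) Y).hom ≫ Y ◁ μ[Γ]) ▷ X ⊗≫ Y ◁ a ≫ e := by
      rw [IsCommMonObj.mul_comm]; monoidal
    _ = _ := by
      rw [← BraidedCategory.braiding_naturality_left]; monoidal

variable [RightRigidCategory C]

/-- The action on the dual of a module. -/
noncomputable def dualAct (M : Mod C Γ) : Γ ⊗ M.Xᘁ ⟶ M.Xᘁ :=
  toDual (X := M.X) ((β_ Γ M.Xᘁ).hom ▷ M.X ≫ (α_ _ _ _).hom ≫ M.Xᘁ ◁ M.act ≫ ε_ M.X M.Xᘁ)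

lemma dualAct_ev (M : Mod C Γ) : M.dualAct ▷ M.X ≫ ε_ M.X M.Xᘁ =
    (β_ Γ M.Xᘁ).hom ▷ M.X ≫ (α_ _ _ _).hom ≫ M.Xᘁ ◁ M.act ≫ ε_ M.X M.Xᘁ :=
  toDual_ev _

lemma one_dualAct (M : Mod C Γ) : η[Γ] ▷ M.Xᘁ ≫ M.dualAct = (λ_ M.Xᘁ).hom := by
  apply ev_ext (X := M.X)
  rw [comp_whiskerRight_assoc, dualAct_ev, ← comp_whiskerRight_assoc,
    BraidedCategory.braiding_naturality_left, braiding_tensorUnit_left]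
  calc _ = 𝟙 _ ⊗≫ (M.Xᘁ : C) ◁ (η[Γ] ▷ M.X ≫ M.act) ⊗≫ ε_ M.X M.Xᘁ := by monoidal
    _ = _ := by rw [one_act]; monoidal

lemma mul_dualAct [IsCommMonObj Γ] (M : Mod C Γ) :
    μ[Γ] ▷ M.Xᘁ ≫ M.dualAct = (α_ _ _ _).hom ≫ Γ ◁ M.dualAct ≫ M.dualAct := by
  apply ev_ext (X := M.X)
  exact pairing_mul_act M.act M.dualAct _ M.mul_act M.dualAct_ev

/-- The dual module. -/
noncomputable def dual [IsCommMonObj Γ] (M : Mod C Γ) : Mod C Γ :=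
  ofAct M.Xᘁ M.dualAct M.one_dualAct M.mul_dualAct

noncomputable instance [IsCommMonObj Γ] (M : Mod C Γ) : ExactPairing M.X M.dual.X :=
  inferInstanceAs (ExactPairing M.X M.Xᘁ)

lemma dual_act_ev [IsCommMonObj Γ] (M : Mod C Γ) : M.dual.act ▷ M.X ≫ ε_ M.X M.dual.X =
    (β_ Γ M.dual.X).hom ▷ M.X ≫ (α_ _ _ _).hom ≫ M.dual.X ◁ M.act ≫ ε_ M.X M.dual.X :=
  M.dualAct_ev

lemma dual_ract_ev [IsCommMonObj Γ] (M : Mod C Γ) :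
    M.dual.ract ▷ M.X ≫ ε_ M.X M.dual.X =
      (α_ _ _ _).hom ≫ M.dual.X ◁ M.act ≫ ε_ M.X M.dual.X := by
  rw [ract, comp_whiskerRight_assoc, dual_act_ev, inv_hom_whiskerRight_assoc]

end Dual

section Rigid

variable {C : Type u} [Category.{v} C] [MonoidalCategory C] [BraidedCategory C]

lemma coev_braiding_inv {A B : C} (κ : 𝟙_ C ⟶ A ⊗ B) (Z : C) :
    κ ▷ Z ⊗≫ A ◁ (β_ Z B).inv ⊗≫ (β_ Z A).inv ▷ B = 𝟙 _ ⊗≫ Z ◁ κ ⊗≫ 𝟙 _ := by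
  have h := BraidedCategory.braiding_inv_naturality_left κ Z
  rw [BraidedCategory.braiding_tensor_right_inv, braiding_inv_tensorUnit_right] at h
  calc _ = (κ ▷ Z ≫ (α_ A B Z).hom ≫ A ◁ (β_ Z B).inv ≫ (α_ A Z B).inv ≫ (β_ Z A).inv ▷ B ≫
          (α_ Z A B).hom) ⊗≫ 𝟙 _ := by monoidal
    _ = _ := by rw [h]; monoidal

/-- The Γ-strand slides across the coevaluation, the snake on X straightens, and the coaction
followed by the action remains. -/
lemma zigzag_act {Γ X Y : C} [ExactPairing X Y] (c : X ⟶ Γ ⊗ X) (a : Γ ⊗ X ⟶ X)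
    (h : c ≫ a = 𝟙 X) :
    (λ_ X).inv ≫ η_ X Y ▷ X ≫ (α_ _ _ _).hom ≫ X ◁ (Y ◁ c ≫ (α_ _ _ _).inv ≫
      (β_ Γ Y).inv ▷ X ≫ (α_ _ _ _).hom ≫ Γ ◁ ε_ X Y ≫ (ρ_ Γ).hom) ≫ (β_ Γ X).inv ≫ a = 𝟙 X := by
  calc _ = 𝟙 _ ⊗≫ (η_ X Y ▷ X ≫ (X ⊗ Y) ◁ c) ⊗≫ X ◁ (β_ Γ Y).inv ▷ X ⊗≫
        (X ◁ Γ ◁ ε_ X Y ⊗≫ (β_ Γ X).inv ▷ 𝟙_ C) ⊗≫ a := by monoidal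
    _ = 𝟙 _ ⊗≫ c ⊗≫ η_ X Y ▷ (Γ ⊗ X) ⊗≫ X ◁ (β_ Γ Y).inv ▷ X ⊗≫
        ((X ⊗ Γ) ◁ ε_ X Y ≫ (β_ Γ X).inv ▷ 𝟙_ C) ⊗≫ a := by
      rw [← whisker_exchange]; monoidal
    _ = 𝟙 _ ⊗≫ c ⊗≫ (η_ X Y ▷ Γ ⊗≫ X ◁ (β_ Γ Y).inv ⊗≫ (β_ Γ X).inv ▷ Y) ▷ X ⊗≫
        Γ ◁ X ◁ ε_ X Y ⊗≫ a := by
      rw [whisker_exchange]; monoidal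
    _ = 𝟙 _ ⊗≫ c ⊗≫ Γ ◁ (η_ X Y ▷ X ⊗≫ X ◁ ε_ X Y) ⊗≫ a := by
      rw [coev_braiding_inv]; monoidal
    _ = 𝟙 _ ⊗≫ (c ≫ a) := by
      rw [ExactPairing.evaluation_coevaluation'']; monoidal
    _ = _ := by rw [h]; monoidal

variable [HasCoequalizers C]
  [∀ X : C, PreservesColimitsOfSize.{0, 0} (tensorLeft X)]
  [∀ X : C, PreservesColimitsOfSize.{0, 0} (tensorRight X)]
  {Γ : C} [MonObj Γ] [IsCommMonObj Γ]

lemma leftUnitor_inv_hom (M : Mod C Γ) :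
    (λ_ M).inv.hom = (λ_ M.X).inv ≫ one Γ ▷ M.X ≫ proj (𝟙_ _) M := by
  have h : one Γ ▷ M.X ≫ proj (𝟙_ _) M ≫ (λ_ M).hom.hom = (λ_ M.X).hom := by
    rw [proj_leftUnitor]; exact M.one_act
  have h2 : (λ_ M).hom.hom ≫ (λ_ M).inv.hom = 𝟙 _ := by
    rw [← comp_hom', Iso.hom_inv_id, id_hom']
  calc _ = (λ_ M.X).inv ≫ (one Γ ▷ M.X ≫ proj (𝟙_ _) M ≫ (λ_ M).hom.hom) ≫ (λ_ M).inv.hom := by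
        rw [h, Iso.inv_hom_id_assoc]
    _ = _ := by simp only [Category.assoc]; rw [h2, Category.comp_id]

variable [RightRigidCategory C] (S : SeparableFrobenius Γ)

/-- The evaluation of the dual module. -/
noncomputable def ev (M : Mod C Γ) : M.dual ⊗ M ⟶ 𝟙_ (Mod C Γ) :=
  S.ofPairing (M := M.dual) (N := M) (ε_ M.X M.dual.X) M.dual_ract_ev

lemma pairing_ev (M : Mod C Γ) : S.pairing (ev S M) = ε_ M.X M.dual.X :=
  S.pairing_ofPairing _ _

/-- The coevaluation of the dual module. -/
noncomputable def coev (M : Mod C Γ) : 𝟙_ (Mod C Γ) ⟶ M ⊗ M.dual :=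
  extend (M := M ⊗ M.dual) (η_ M.X M.dual.X ≫ proj M M.dual)

lemma one_coev (M : Mod C Γ) : one Γ ≫ (coev M).hom = η_ M.X M.dual.X ≫ proj M M.dual :=
  one_comp_extend _

/-- After the unitors are moved over, both sides are endomorphisms of M. In `C` the Γ-valued
evaluation inserts a coaction on M, and the claim reduces to `zigzag_act`. -/
lemma coev_ev (M : Mod C Γ) : coev M ▷ M ≫ (α_ _ _ _).hom ≫ M ◁ ev S M =
    (λ_ M).hom ≫ (ρ_ M).inv := by
  rw [Iso.eq_comp_inv, ← Iso.inv_comp_eq_id]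
  apply Mod.hom_ext
  simp only [comp_hom', Category.assoc, id_hom']
  rw [leftUnitor_inv_hom]
  simp only [Category.assoc]
  rw [reassoc_of% proj_whiskerRight, ← comp_whiskerRight_assoc, one_coev,
    comp_whiskerRight_assoc, reassoc_of% proj_associator]
  rw [SeparableFrobenius.proj_whiskerLeft_rightUnitor, ← MonoidalCategory.whiskerLeft_comp_assoc,
    S.proj_pairing', pairing_ev]
  exact zigzag_act (S.coact M) M.act (S.coact_act M)

/-- The exact pairing of a module and its dual. -/
@[reducible]
noncomputable def exactPairing (M : Mod C Γ) : ExactPairing M M.dual :=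
  exactPairingOfNondegenerate (coev M) (ev S M) (coev_ev S M) (fun q hq => by
    apply Mod.hom_ext
    apply ev_ext (X := M.X)
    have h := congrArg S.pairing hq
    rw [SeparableFrobenius.pairing, comp_hom', Category.assoc, reassoc_of% proj_whiskerRight,
      ← SeparableFrobenius.pairing, pairing_ev] at h
    rw [h, id_hom', id_whiskerRight, Category.id_comp])

/-- The category of modules is right rigid. -/
@[reducible]
noncomputable def rightRigid : RightRigidCategory (Mod C Γ) where
  rightDual M := { rightDual := M.dual, exact := exactPairing S M }

end Rigid

end Mod

/-! ### The pivotal and spherical structures on modules -/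

lemma tensorHom_nested_ev {D : Type u} [Category.{v} D] [MonoidalCategory D] {X Y X' Y' X'' Y'' : D}
    [ExactPairing X' X''] [ExactPairing Y' Y''] (p : X ⟶ X'') (q : Y ⟶ Y'') :
    (p ⊗ₘ q) ▷ (Y' ⊗ X') ≫ ε_ (Y' ⊗ X') (X'' ⊗ Y'') =
      𝟙 _ ⊗≫ X ◁ ((q ▷ Y' ≫ ε_ Y' Y'') ▷ X') ⊗≫ (p ▷ X' ≫ ε_ X' X'') := by
  rw [ExactPairing.tensor_evaluation, tensorHom_def']
  calc _ = 𝟙 _ ⊗≫ X ◁ (q ▷ Y') ▷ X' ⊗≫ (p ▷ ((Y'' ⊗ Y') ⊗ X') ≫ X'' ◁ (ε_ Y' Y'' ▷ X')) ⊗≫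
        ε_ X' X'' := by monoidal
    _ = _ := by rw [← whisker_exchange]; monoidal

/-- A family of isomorphisms is compatible with the tensor product if the pairings that it defines
are. -/
lemma pivot_tensor_of_nested {D : Type u} [Category.{v} D] [MonoidalCategory D]
    [RightRigidCategory D] {X Y : D} (p : X ⟶ (Xᘁ)ᘁ) (q : Y ⟶ (Yᘁ)ᘁ) (r : X ⊗ Y ⟶ ((X ⊗ Y)ᘁ)ᘁ)
    (h : (X ⊗ Y) ◁ (rightDualTensorIso X Y).inv ≫ r ▷ (X ⊗ Y)ᘁ ≫ ε_ (X ⊗ Y)ᘁ ((X ⊗ Y)ᘁ)ᘁ =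
      𝟙 _ ⊗≫ X ◁ ((q ▷ Yᘁ ≫ ε_ Yᘁ (Yᘁ)ᘁ) ▷ Xᘁ) ⊗≫ (p ▷ Xᘁ ≫ ε_ Xᘁ (Xᘁ)ᘁ)) :
    r = (p ⊗ₘ q) ≫ @rightAdjointMate D _ _ ((X ⊗ Y)ᘁ) (Yᘁ ⊗ Xᘁ) _ hasRightDualTensor
        (rightDualTensorIso X Y).hom := by
  apply ev_ext (X := (X ⊗ Y)ᘁ)
  have e := @rightAdjointMate_comp_evaluation D _ _ ((X ⊗ Y)ᘁ) (Yᘁ ⊗ Xᘁ) _ hasRightDualTensor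
    (rightDualTensorIso X Y).hom
  refine Eq.trans ?_ (comp_whiskerRight_assoc _ _ _ _).symm
  refine Eq.trans ?_ (congrArg (fun t => _ ≫ t) e.symm)
  refine Eq.trans ?_ (whisker_exchange_assoc _ _ _)
  refine Eq.trans ?_ (congrArg (fun t => _ ≫ t) (tensorHom_nested_ev p q).symm)
  rw [← h, ← MonoidalCategory.whiskerLeft_comp_assoc, Iso.hom_inv_id]
  simp

namespace Mod

section Balanced

open RibbonCategory

variable {C : Type u} [Category.{v} C] [MonoidalCategory C] [BraidedCategory C]
  [RightRigidCategory C] [RibbonCategory C] {Γ : C} [MonObj Γ] [IsCommMonObj Γ]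

/-- Naturality of the twist along the action produces a double braiding of Γ with M and the twists
of Γ and M. Triviality of the twist on Γ leaves only the twist of M, and the transposed action
absorbs the braidings. -/
lemma act_revEv (hθ : (twist Γ).hom = 𝟙 Γ) (M : Mod C Γ) :
    M.act ▷ M.dual.X ≫ revEv M.X M.dual.X =
      (β_ Γ M.X).hom ▷ M.dual.X ≫ (α_ _ _ _).hom ≫ M.X ◁ M.dual.act ≫ revEv M.X M.dual.X := by
  have h1 : M.act ≫ (twist M.X).hom =
      (β_ Γ M.X).hom ≫ (twist M.X).hom ▷ Γ ≫ (β_ M.X Γ).hom ≫ M.act := by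
    rw [twist_naturality, twist_tensor, hθ, id_tensorHom,
      BraidedCategory.braiding_naturality_left_assoc, Category.assoc, Category.assoc]
  unfold revEv
  rw [← comp_whiskerRight_assoc, h1, whisker_exchange_assoc,
    BraidedCategory.braiding_naturality_right_assoc, dual_act_ev]
  simp only [comp_whiskerRight_assoc]
  rw [BraidedCategory.braiding_naturality_left_assoc, BraidedCategory.braiding_tensor_left_hom,
    BraidedCategory.braiding_tensor_right_hom]
  simp

/-- The isomorphism of the underlying object with that of the double dual. -/
noncomputable def pivotIso (M : Mod C Γ) : M.X ≅ M.dual.dual.X :=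
  doubleDualIso M.X M.dual.X M.dual.dual.X

lemma act_pivotIso (hθ : (twist Γ).hom = 𝟙 Γ) (M : Mod C Γ) :
    M.act ≫ M.pivotIso.hom = Γ ◁ M.pivotIso.hom ≫ M.dual.dual.act := by
  apply ev_ext (X := M.dual.X)
  rw [comp_whiskerRight_assoc, pivotIso, doubleDualIso_hom_ev, act_revEv hθ,
    comp_whiskerRight_assoc, dual_act_ev, ← comp_whiskerRight_assoc,
    BraidedCategory.braiding_naturality_right, comp_whiskerRight_assoc,
    ← doubleDualIso_hom_ev M.X M.dual.X M.dual.dual.X]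
  simp [whisker_exchange_assoc]

/-- The isomorphism of a module with its double dual. -/
noncomputable def pivot (hθ : (twist Γ).hom = 𝟙 Γ) (M : Mod C Γ) : M ≅ M.dual.dual where
  hom := homOfAct M.pivotIso.hom (act_pivotIso hθ M)
  inv := homOfAct M.pivotIso.inv (by
    rw [← cancel_mono M.pivotIso.hom, Category.assoc, Category.assoc, act_pivotIso hθ,
      whiskerLeft_inv_hom_assoc, Iso.inv_hom_id, Category.comp_id])
  hom_inv_id := Mod.hom_ext _ _ M.pivotIso.hom_inv_id
  inv_hom_id := Mod.hom_ext _ _ M.pivotIso.inv_hom_id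

end Balanced

section Pivotal

open RibbonCategory SeparableFrobenius

variable {C : Type u} [Category.{v} C] [MonoidalCategory C] [BraidedCategory C]
  [HasCoequalizers C]
  [∀ X : C, PreservesColimitsOfSize.{0, 0} (tensorLeft X)]
  [∀ X : C, PreservesColimitsOfSize.{0, 0} (tensorRight X)]
  {Γ : C} [MonObj Γ] [IsCommMonObj Γ] (S : SeparableFrobenius Γ)

lemma pairing_whiskerRight {M M' N : Mod C Γ} (f : M ⟶ M') (B : M' ⊗ N ⟶ 𝟙_ (Mod C Γ)) :
    S.pairing (f ▷ N ≫ B) = f.hom ▷ N.X ≫ S.pairing B := by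
  rw [pairing, comp_hom', Category.assoc, reassoc_of% proj_whiskerRight, ← pairing]

lemma pairing_whiskerLeft {M N N' : Mod C Γ} (f : N ⟶ N') (B : M ⊗ N' ⟶ 𝟙_ (Mod C Γ)) :
    S.pairing (M ◁ f ≫ B) = M.X ◁ f.hom ≫ S.pairing B := by
  rw [pairing, comp_hom', Category.assoc, reassoc_of% proj_whiskerLeft, ← pairing]

variable [RightRigidCategory C]

/-- On underlying objects the mate of a module map satisfies the defining equation of its mate in
`C`, so naturality of the pivotal structure can be taken from `C`. -/
lemma rightAdjointMate_hom_ev {M N : Mod C Γ} (f : M ⟶ N) :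
    letI := rightRigid S
    (rightAdjointMate f).hom ▷ M.X ≫ ε_ M.X M.dual.X = N.dual.X ◁ f.hom ≫ ε_ N.X N.dual.X := by
  let _ := rightRigid S
  have h : rightAdjointMate f ▷ M ≫ ev S M = N.dual ◁ f ≫ ev S N :=
    rightAdjointMate_comp_evaluation f
  have h2 := congrArg S.pairing h
  refine Eq.trans ?_ (h2.trans ?_)
  · refine Eq.trans ?_ (pairing_whiskerRight S _ _).symm
    rw [pairing_ev]
  · refine (pairing_whiskerLeft S (M := N.dual) f (ev S N)).trans ?_
    rw [pairing_ev]

variable [RibbonCategory C]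

lemma pairing_pivot (hθ : (twist Γ).hom = 𝟙 Γ) (M : Mod C Γ) :
    S.pairing ((pivot hθ M).hom ▷ M.dual ≫ ev S M.dual) = revEv M.X M.dual.X := by
  rw [pairing_whiskerRight, pairing_ev]
  exact doubleDualIso_hom_ev _ _ _

instance tensorHom_proj_epi (M N M' N' : Mod C Γ) : Epi (proj M N ⊗ₘ proj M' N') := by
  rw [MonoidalCategory.tensorHom_def]
  infer_instance

/-- In terms of pairings in `C` this is `revEv_tensor`. The projectors separating nested module
pairings from nested pairings in `C` disappear after composition with `proj`. -/
lemma pivot_nested (hθ : (twist Γ).hom = 𝟙 Γ) (M N : Mod C Γ)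
    (J : N.dual ⊗ M.dual ⟶ (M ⊗ N).dual)
    (hJ : J ▷ (M ⊗ N) ≫ ev S (M ⊗ N) =
      𝟙 _ ⊗≫ N.dual ◁ (ev S M ▷ N) ⊗≫ ev S N) :
    (M ⊗ N) ◁ J ≫ (pivot hθ (M ⊗ N)).hom ▷ (M ⊗ N).dual ≫ ev S (M ⊗ N).dual =
      𝟙 _ ⊗≫ M ◁ (((pivot hθ N).hom ▷ N.dual ≫ ev S N.dual) ▷ M.dual) ⊗≫
        ((pivot hθ M).hom ▷ M.dual ≫ ev S M.dual) := by
  apply S.pairing_ext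
  rw [pairing_whiskerLeft, pairing_pivot]
  rw [← cancel_epi (proj M N ⊗ₘ proj N.dual M.dual)]
  have hB := S.proj_nested ((pivot hθ N).hom ▷ N.dual ≫ ev S N.dual)
    ((pivot hθ M).hom ▷ M.dual ≫ ev S M.dual)
  rw [pairing_pivot, pairing_pivot, ← revEv_tensor] at hB
  have hJ' := congrArg (fun t => (proj N.dual M.dual ⊗ₘ proj M N) ≫ S.pairing t) hJ
  simp only [pairing_whiskerRight, proj_nested, pairing_ev] at hJ'
  -- The mate of the projection `proj M N`. Up to `J`, it embeds the tensor product of the dual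
  -- modules as the image of their projector.
  let g : (M ⊗ N).dual.X ⟶ N.dual.X ⊗ M.dual.X :=
    toDual (X := M.X ⊗ N.X) ((M ⊗ N).dual.X ◁ proj M N ≫ ε_ (M ⊗ N).X (M ⊗ N).dual.X)
  have hg : g ▷ (M.X ⊗ N.X) ≫ ε_ (M.X ⊗ N.X) (N.dual.X ⊗ M.dual.X) =
    (M ⊗ N).dual.X ◁ proj M N ≫ ε_ (M ⊗ N).X (M ⊗ N).dual.X := toDual_ev _
  have hr : proj N.dual M.dual ≫ J.hom ≫ g = S.projector N.dual M.dual := by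
    apply ev_ext (X := M.X ⊗ N.X)
    rw [comp_whiskerRight_assoc, comp_whiskerRight_assoc, hg]
    rw [ExactPairing.tensor_evaluation, ← hJ', MonoidalCategory.tensorHom_def]
    simp [whisker_exchange_assoc]
  have hL : (proj M N ⊗ₘ proj N.dual M.dual) ≫ (M ⊗ N).X ◁ J.hom ≫
      revEv (M ⊗ N).X (M ⊗ N).dual.X =
      (M.X ⊗ N.X) ◁ S.projector N.dual M.dual ≫
        revEv (M.X ⊗ N.X) (N.dual.X ⊗ M.dual.X) := by
    rw [← hr, tensorHom_def', Category.assoc]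
    rw [← whisker_exchange_assoc, revEv_naturality (proj M N) g hg]
    simp
  have h1 : S.projector M N ▷ (N.dual.X ⊗ M.dual.X) ≫ (proj M N ⊗ₘ proj N.dual M.dual) =
      proj M N ⊗ₘ proj N.dual M.dual := by
    rw [MonoidalCategory.tensorHom_def, ← comp_whiskerRight_assoc, projector_proj]
  have h2 : (M.X ⊗ N.X) ◁ S.projector N.dual M.dual ≫ (proj M N ⊗ₘ proj N.dual M.dual) =
      proj M N ⊗ₘ proj N.dual M.dual := by
    rw [tensorHom_def', ← MonoidalCategory.whiskerLeft_comp_assoc, projector_proj]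
  -- Both projectors are inserted for free in front of the projections. One matches the projector
  -- from `proj_nested`, the other that from `hL`.
  refine Eq.trans (congrArg (fun t => t ≫ _) h1.symm) (Eq.trans ?_ (congrArg (fun t => t ≫ _) h2))
  rw [Category.assoc, Category.assoc, hL]
  refine Eq.trans ?_ (congrArg (fun t => _ ≫ t) hB.symm)
  rw [whisker_exchange_assoc]

end Pivotal

end Mod

lemma rightDualTensorIso_inv_ev {D : Type u} [Category.{v} D] [MonoidalCategory D]
    [RightRigidCategory D] (X Y : D) :
    (rightDualTensorIso X Y).inv ▷ (X ⊗ Y) ≫ ε_ (X ⊗ Y) (X ⊗ Y)ᘁ =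
      𝟙 _ ⊗≫ (Yᘁ : D) ◁ (ε_ X Xᘁ ▷ Y) ⊗≫ ε_ Y Yᘁ := by
  rw [← ExactPairing.tensor_evaluation]
  exact rightDualIso_hom_ev _ _

namespace Mod

open RibbonCategory SeparableFrobenius

variable {C : Type u} [Category.{v} C] [MonoidalCategory C] [BraidedCategory C]
  [HasCoequalizers C]
  [∀ X : C, PreservesColimitsOfSize.{0, 0} (tensorLeft X)]
  [∀ X : C, PreservesColimitsOfSize.{0, 0} (tensorRight X)]
  [RightRigidCategory C] [RibbonCategory C]
  {Γ : C} [MonObj Γ] [IsCommMonObj Γ] (S : SeparableFrobenius Γ)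

/-- The pivotal structure on the category of modules over an algebra with trivial twist. -/
@[reducible]
noncomputable def pivotal (hθ : (twist Γ).hom = 𝟙 Γ) :
    letI := rightRigid S
    PivotalCategory (Mod C Γ) :=
  letI := rightRigid S
  { pivot := pivot hθ
    pivot_naturality := fun {M N} f => Mod.hom_ext _ _ <|
      doubleDualIso_naturality (X' := M.dual.X) (X'' := M.dual.dual.X) (Y' := N.dual.X)
        (Y'' := N.dual.dual.X) f.hom (rightAdjointMate f).hom
        (rightAdjointMate (rightAdjointMate f)).hom
        (rightAdjointMate_hom_ev S f) (rightAdjointMate_hom_ev S (rightAdjointMate f))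
    pivot_tensor := fun M N => pivot_tensor_of_nested _ _ _ <|
      pivot_nested S hθ M N _ (rightDualTensorIso_inv_ev M N) }

/-- The unit of Γ turns the module coevaluation into that of `C`, and the counit turns the reversed
evaluation of modules into `revEv`. Together they turn the module trace into the ribbon trace. -/
lemma one_rightTrace_counit (hθ : (twist Γ).hom = 𝟙 Γ) {M : Mod C Γ} (h : M ⟶ M) :
    letI := rightRigid S
    letI := pivotal S hθ
    one Γ ≫ (rightTrace h).hom ≫ S.counitMod = ribbonTrace h.hom := by
  let _ := rightRigid S
  let _ := pivotal S hθ
  have h1 : (rightTrace h) = coev M ≫ h ▷ M.dual ≫ (pivot hθ M).hom ▷ M.dual ≫ ev S M.dual := by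
    rw [← comp_whiskerRight_assoc]
    rfl
  rw [h1, comp_hom', Category.assoc, reassoc_of% one_coev]
  refine Eq.trans (congrArg (fun t => _ ≫ t) (pairing_whiskerRight S h _)) ?_
  rw [pairing_pivot, ribbonTrace_eq_of_exactPairing M.dual.X]

lemma one_leftTrace_counit (hθ : (twist Γ).hom = 𝟙 Γ) {M : Mod C Γ} (h : M ⟶ M) :
    letI := rightRigid S
    letI := pivotal S hθ
    one Γ ≫ (leftTrace h).hom ≫ S.counitMod = ribbonTrace h.hom := by
  let _ := rightRigid S
  let _ := pivotal S hθ
  have h1 : (leftTrace h) = coev M.dual ≫ M.dual ◁ ((pivot hθ M).inv ≫ h) ≫ ev S M := rfl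
  rw [h1, comp_hom', Category.assoc, reassoc_of% one_coev]
  refine Eq.trans (congrArg (fun t => _ ≫ t) (pairing_whiskerLeft S ((pivot hθ M).inv ≫ h) _)) ?_
  rw [pairing_ev, comp_hom']
  exact leftTrace_doubleDual M.dual.X M.dual.dual.X h.hom

/-- The spherical structure on the category of modules. -/
@[reducible]
noncomputable def spherical (hθ : (twist Γ).hom = 𝟙 Γ)
    (hend : ∀ f g : 𝟙_ (Mod C Γ) ⟶ 𝟙_ (Mod C Γ),
      one Γ ≫ f.hom ≫ S.counitMod = one Γ ≫ g.hom ≫ S.counitMod → f = g) :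
    letI := rightRigid S
    SphericalCategory (Mod C Γ) :=
  letI := rightRigid S
  { toPivotalCategory := pivotal S hθ
    leftTrace_eq_rightTrace := fun f => hend _ _ <|
      (one_leftTrace_counit S hθ f).trans (one_rightTrace_counit S hθ f).symm }

end Mod

/-! ### Triviality of the twist of Γ -/

namespace SeparableFrobenius

section Twist

open RibbonCategory

variable {C : Type u} [Category.{v} C] [MonoidalCategory C] [BraidedCategory C]
  [RightRigidCategory C] [RibbonCategory C] {Γ : C} [MonObj Γ] (S : SeparableFrobenius Γ)

/-- The element of `Γ` obtained from the copairing by twisting one factor and multiplying. -/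
def twistElement : 𝟙_ C ⟶ Γ := S.copairing ≫ (twist Γ).hom ▷ Γ ≫ μ[Γ]

lemma twistElement_eq (hθ : (twist Γ).hom = 𝟙 Γ) : S.twistElement = η[Γ] := by
  rw [twistElement, hθ, id_whiskerRight, Category.id_comp, S.copairing_mul]

variable [IsCommMonObj Γ]

/-- The twist of Γ ⊗ Γ contains a double braiding, which commutativity of the multiplication absorbs
twice. -/
lemma mul_twist : μ[Γ] ≫ (twist Γ).hom = ((twist Γ).hom ⊗ₘ (twist Γ).hom) ≫ μ[Γ] := by
  rw [twist_naturality, twist_tensor]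
  simp only [Category.assoc]
  rw [← BraidedCategory.braiding_naturality_assoc, ← BraidedCategory.braiding_naturality_assoc,
    IsCommMonObj.mul_comm, IsCommMonObj.mul_comm]

/-- With t = Σ θ(eᵢ)eⁱ: θ(x)t = Σ θ(xeᵢ)eⁱ = Σ θ(eᵢ)eⁱx = tx, by multiplicativity of θ and
centrality of the copairing. -/
lemma twist_mul_twistElement :
    (ρ_ Γ).inv ≫ Γ ◁ S.twistElement ≫ (twist Γ).hom ▷ Γ ≫ μ[Γ] =
      (λ_ Γ).inv ≫ S.twistElement ▷ Γ ≫ μ[Γ] := by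
  unfold twistElement
  calc _ = 𝟙 _ ⊗≫ Γ ◁ S.copairing ⊗≫ (Γ ◁ (twist Γ).hom ≫ (twist Γ).hom ▷ Γ) ▷ Γ ⊗≫
          (Γ ◁ μ[Γ] ≫ μ[Γ]) := by
        rw [MonoidalCategory.whiskerLeft_comp_assoc, MonoidalCategory.whiskerLeft_comp_assoc,
          whisker_exchange_assoc]
        have h : Γ ◁ (twist Γ).hom ▷ Γ ≫ (twist Γ).hom ▷ (Γ ⊗ Γ) =
          𝟙 _ ⊗≫ (Γ ◁ (twist Γ).hom ≫ (twist Γ).hom ▷ Γ) ▷ Γ ⊗≫ 𝟙 _ := by monoidal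
        rw [reassoc_of% h]
        monoidal
    _ = 𝟙 _ ⊗≫ Γ ◁ S.copairing ⊗≫ (((twist Γ).hom ⊗ₘ (twist Γ).hom) ≫ μ[Γ]) ▷ Γ ≫ μ[Γ] := by
        rw [comp_whiskerRight_assoc, MonObj.mul_assoc, tensorHom_def']; monoidal
    _ = 𝟙 _ ⊗≫ (Γ ◁ S.copairing ⊗≫ μ[Γ] ▷ Γ) ≫ (twist Γ).hom ▷ Γ ≫ μ[Γ] := by
        rw [← mul_twist]; monoidal
    _ = 𝟙 _ ⊗≫ S.copairing ▷ Γ ⊗≫ (Γ ◁ μ[Γ] ≫ (twist Γ).hom ▷ Γ) ≫ μ[Γ] := by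
        rw [S.central']; monoidal
    _ = 𝟙 _ ⊗≫ S.copairing ▷ Γ ≫ (twist Γ).hom ▷ Γ ▷ Γ ≫ ((α_ _ _ _).hom ≫ Γ ◁ μ[Γ] ≫ μ[Γ]) := by
        rw [whisker_exchange]; monoidal
    _ = _ := by rw [← MonObj.mul_assoc]; monoidal

/-- Γ is its own dual by `selfPairing`, and commutativity removes the braiding from the loop; the
twist remains. -/
lemma ribbonTrace_id_eq : ribbonTrace (𝟙 Γ) = S.twistElement ≫ S.counit := by
  let _ := S.selfPairing
  rw [ribbonTrace_eq_of_exactPairing Γ, id_whiskerRight, Category.id_comp, revEv]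
  have h : (β_ Γ Γ).hom ≫ μ[Γ] ≫ S.counit = μ[Γ] ≫ S.counit := by
    rw [← Category.assoc, IsCommMonObj.mul_comm]
  change S.copairing ≫ _ ≫ (β_ Γ Γ).hom ≫ μ[Γ] ≫ S.counit = _
  rw [h, twistElement]
  simp only [Category.assoc]

variable [Preadditive C] [MonoidalPreadditive C] {F : Type w} [Field F] [Linear F C]
  [MonoidalLinear F C]

lemma twist_eq_id {c : F} (hc : c ≠ 0) (h : S.twistElement = c • η[Γ]) :
    (twist Γ).hom = 𝟙 Γ := by
  have h1 := S.twist_mul_twistElement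
  rw [h, MonoidalLinear.whiskerLeft_smul, MonoidalLinear.smul_whiskerRight] at h1
  simp only [Linear.smul_comp, Linear.comp_smul] at h1
  have h2 := smul_right_injective _ hc h1
  rw [MonObj.one_mul, Iso.inv_hom_id, whisker_exchange_assoc, MonObj.mul_one] at h2
  rw [← h2]
  simp

end Twist

section OfIsStronglySeparable

variable {F : Type w} [Field F] {C : Type u} [Category.{v} C] [Preadditive C] [Linear F C]
  [MonoidalCategory C] [MonoidalPreadditive C] [MonoidalLinear F C] {Γ : C} [MonObj Γ] [ComonObj Γ]

/-- The normalized counit and copairing of a strongly separable Frobenius algebra. -/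
def ofIsStronglySeparable (hΓ : IsStronglySeparableFrobenius F Γ) {a : F} (ha : a ≠ 0)
    (h : Δ[Γ] ≫ μ[Γ] = a • 𝟙 Γ) : SeparableFrobenius Γ where
  counit := a • ε[Γ]
  copairing := a⁻¹ • (η[Γ] ≫ Δ[Γ])
  central := by
    simp only [MonoidalLinear.whiskerLeft_smul, MonoidalLinear.smul_whiskerRight,
      Linear.smul_comp, Linear.comp_smul, MonoidalCategory.whiskerLeft_comp, comp_whiskerRight,
      Category.assoc]
    rw [hΓ.frobenius_left, hΓ.frobenius_right, MonObj.mul_one_assoc, MonObj.one_mul_assoc,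
      Iso.inv_hom_id_assoc, Iso.inv_hom_id_assoc]
  copairing_mul := by
    rw [Linear.smul_comp, Category.assoc, h, Linear.comp_smul, Category.comp_id, smul_smul,
      inv_mul_cancel₀ ha, one_smul]
  counit_left := by
    rw [MonoidalLinear.smul_whiskerRight]
    simp [smul_smul, mul_inv_cancel₀ ha]
  counit_right := by
    rw [MonoidalLinear.whiskerLeft_smul]
    simp [smul_smul, mul_inv_cancel₀ ha]

end OfIsStronglySeparable

end SeparableFrobenius

/-! ### Scalars and comparison of the two traces -/

section UnitScalar

variable {F : Type w} [Field F] {D : Type u} [Category.{v} D] [Preadditive D] [Linear F D]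
  [MonoidalCategory D]

lemma unitScalar_smul_id (h : Function.Injective (fun c : F => c • 𝟙 (𝟙_ D))) (c : F) :
    unitScalar F (c • 𝟙 (𝟙_ D)) = c :=
  Function.leftInverse_invFun h c

lemma smul_unitScalar_id (h : Function.Bijective (fun c : F => c • 𝟙 (𝟙_ D))) (f : 𝟙_ D ⟶ 𝟙_ D) :
    unitScalar F f • 𝟙 (𝟙_ D) = f :=
  Function.rightInverse_invFun h.2 f

end UnitScalar

namespace Mod

open RibbonCategory SeparableFrobenius

variable {F : Type w} [Field F] {C : Type u} [Category.{v} C] [Preadditive C] [Linear F C]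
  [MonoidalCategory C] [MonoidalPreadditive C] [MonoidalLinear F C]
  [BraidedCategory C] [HasCoequalizers C]
  [∀ X : C, PreservesColimitsOfSize.{0, 0} (tensorLeft X)]
  [∀ X : C, PreservesColimitsOfSize.{0, 0} (tensorRight X)]
  {Γ : C} [MonObj Γ] [IsCommMonObj Γ]

/-- Endomorphisms of the unit module correspond to elements 1 ⟶ Γ, and these are the multiples of η.
-/
lemma end_unit_bijective (h0 : η[Γ] ≠ 0) (h : ∀ x : 𝟙_ C ⟶ Γ, ∃ c : F, c • η[Γ] = x) :
    Function.Bijective (fun c : F => c • 𝟙 (𝟙_ (Mod C Γ))) := by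
  have key (c : F) : one Γ ≫ (c • 𝟙 (𝟙_ (Mod C Γ))).hom = c • η[Γ] := by
    rw [smul_hom, id_hom', Linear.comp_smul, Category.comp_id]; rfl
  refine ⟨fun c d hcd => ?_, fun f => ?_⟩
  · have := congrArg (fun f => one Γ ≫ Mod.Hom.hom f) hcd
    simp only [key] at this
    exact smul_left_injective F h0 this
  · obtain ⟨c, hc⟩ := h (one Γ ≫ f.hom)
    exact ⟨c, extend_ext ((key c).trans hc)⟩

lemma one_smul_counitMod (S : SeparableFrobenius Γ) (c : F) :
    one Γ ≫ (c • 𝟙 (𝟙_ (Mod C Γ))).hom ≫ S.counitMod = c • (η[Γ] ≫ S.counit) := by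
  rw [smul_hom, id_hom', Linear.smul_comp, Category.id_comp, Linear.comp_smul]; rfl

variable [RightRigidCategory C] [RibbonCategory C]

/-- A module trace c·id closes off to c·(η ≫ counit), and with trivial twist the scalar of η ≫
counit is d(Γ). -/
lemma unitScalar_ribbonTrace (S : SeparableFrobenius Γ) (hθ : (twist Γ).hom = 𝟙 Γ)
    (hC : Function.Bijective (fun c : F => c • 𝟙 (𝟙_ C)))
    (hM : Function.Bijective (fun c : F => c • 𝟙 (𝟙_ (Mod C Γ)))) {Y : Mod C Γ} (h : Y ⟶ Y) :
    letI := rightRigid S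
    letI := pivotal S hθ
    unitScalar F (ribbonTrace h.hom) = ribbonDim F Γ * unitScalar F (rightTrace h) := by
  let _ := rightRigid S
  let _ := pivotal S hθ
  obtain ⟨c, hc⟩ := hM.2 (rightTrace h)
  obtain ⟨b, hb⟩ := hC.2 (η[Γ] ≫ S.counit)
  dsimp only at hc hb
  have h1 := one_rightTrace_counit S hθ h
  rw [← hc, one_smul_counitMod, ← hb, smul_smul] at h1
  rw [← h1, ← hc, ribbonDim, S.ribbonTrace_id_eq, S.twistElement_eq hθ, ← hb,
    unitScalar_smul_id hC.1, unitScalar_smul_id hC.1, unitScalar_smul_id hM.1, mul_comm]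

end Mod

/-! ### Generalized inverses and abelian categories -/

/-- Every morphism has a generalized inverse. -/
def HasGeneralizedInverses (D : Type u) [Category.{v} D] : Prop :=
  ∀ ⦃X Y : D⦄ (f : X ⟶ Y), ∃ g : Y ⟶ X, f ≫ g ≫ f = f

lemma HasGeneralizedInverses.exists_retraction {D : Type u} [Category.{v} D]
    (hD : HasGeneralizedInverses D) {X Y : D}
    (f : X ⟶ Y) [Mono f] : ∃ g : Y ⟶ X, f ≫ g = 𝟙 X := by
  obtain ⟨g, hg⟩ := hD f
  exact ⟨g, by rw [← cancel_mono f]; simpa using hg⟩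

lemma HasGeneralizedInverses.exists_section {D : Type u} [Category.{v} D]
    (hD : HasGeneralizedInverses D) {X Y : D}
    (f : X ⟶ Y) [Epi f] : ∃ g : Y ⟶ X, g ≫ f = 𝟙 Y := by
  obtain ⟨g, hg⟩ := hD f
  exact ⟨g, by rw [← cancel_epi f]; simpa using hg⟩

section Abelian

variable {D : Type u} [Category.{v} D] [Preadditive D]

lemma HasGeneralizedInverses.hasKernel [IsIdempotentComplete D] (hD : HasGeneralizedInverses D)
    {X Y : D} (f : X ⟶ Y) : HasKernel f := by
  obtain ⟨g, hg⟩ := hD f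
  -- Since f ≫ g is idempotent and f ≫ g ≫ f = f, the image of the complementary idempotent is the
  -- kernel of f.
  obtain ⟨K, i, e, h1, h2⟩ := IsIdempotentComplete.idempotents_split X (𝟙 X - f ≫ g)
    (Idempotents.idem_of_id_sub_idem _ (by simp [reassoc_of% hg]))
  have hi : i ≫ f = 0 := by
    rw [← Category.id_comp i, ← h1, Category.assoc, Category.assoc, reassoc_of% h2,
      Preadditive.sub_comp, Category.id_comp, Category.assoc, hg, sub_self, comp_zero]
  exact HasLimit.mk ⟨KernelFork.ofι i hi, KernelFork.IsLimit.ofι i hi (fun k _ => k ≫ e)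
    (fun k hk => by rw [Category.assoc, h2, Preadditive.comp_sub, reassoc_of% hk]; simp)
    (fun k _ m hm => by rw [← hm, Category.assoc, h1, Category.comp_id])⟩

lemma HasGeneralizedInverses.hasCokernel [IsIdempotentComplete D] (hD : HasGeneralizedInverses D)
    {X Y : D} (f : X ⟶ Y) : HasCokernel f := by
  obtain ⟨g, hg⟩ := hD f
  obtain ⟨K, i, e, h1, h2⟩ := IsIdempotentComplete.idempotents_split Y (𝟙 Y - g ≫ f)
    (Idempotents.idem_of_id_sub_idem _ (by simp [hg]))
  have he : f ≫ e = 0 := by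
    rw [← Category.comp_id e, ← h1, reassoc_of% h2, Preadditive.sub_comp, Preadditive.comp_sub,
      Category.id_comp, Category.assoc, reassoc_of% hg, sub_self]
  exact HasColimit.mk ⟨CokernelCofork.ofπ e he, CokernelCofork.IsColimit.ofπ e he
    (fun k _ => i ≫ k)
    (fun k hk => by rw [reassoc_of% h2, Preadditive.sub_comp, Category.assoc, hk]; simp)
    (fun k _ m hm => by rw [← hm, reassoc_of% h1])⟩

/-- A split monomorphism is a kernel. -/
@[reducible]
def normalMonoOfRetraction {X Y : D} {f : X ⟶ Y} {g : Y ⟶ X} (h : f ≫ g = 𝟙 X) : NormalMono f where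
  Z := Y
  g := 𝟙 Y - g ≫ f
  w := by rw [Preadditive.comp_sub, reassoc_of% h, Category.comp_id, sub_self]
  isLimit := KernelFork.IsLimit.ofι _ _ (fun k _ => k ≫ g)
    (fun k hk => by
      rw [Preadditive.comp_sub, Category.comp_id, sub_eq_zero] at hk
      rw [Category.assoc, ← hk])
    (fun k _ m hm => by rw [← hm, Category.assoc, h, Category.comp_id])

/-- A split epimorphism is a cokernel. -/
@[reducible]
def normalEpiOfSection {X Y : D} {f : X ⟶ Y} {g : Y ⟶ X} (h : g ≫ f = 𝟙 Y) : NormalEpi f where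
  W := X
  g := 𝟙 X - f ≫ g
  w := by rw [Preadditive.sub_comp, Category.assoc, h, Category.comp_id, Category.id_comp, sub_self]
  isColimit := CokernelCofork.IsColimit.ofπ _ _ (fun k _ => g ≫ k)
    (fun k hk => by
      rw [Preadditive.sub_comp, Category.id_comp, sub_eq_zero] at hk
      rw [← Category.assoc, ← hk])
    (fun k _ m hm => by rw [← hm, reassoc_of% h])

/-- An idempotent complete additive category with generalized inverses is abelian. -/
@[reducible]
def HasGeneralizedInverses.abelian [IsIdempotentComplete D] [HasZeroObject D]
    [HasBinaryBiproducts D] (hD : HasGeneralizedInverses D) : Abelian D where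
  normalMonoOfMono f _ := by
    obtain ⟨g, hg⟩ := hD.exists_retraction f
    exact ⟨normalMonoOfRetraction hg⟩
  normalEpiOfEpi f _ := by
    obtain ⟨g, hg⟩ := hD.exists_section f
    exact ⟨normalEpiOfSection hg⟩
  has_finite_products := hasFiniteProducts_of_has_binary_and_terminal
  has_kernels := ⟨fun f => hD.hasKernel f⟩
  has_cokernels := ⟨fun f => hD.hasCokernel f⟩

end Abelian

/-! ### Decompositions into simple objects -/

/-- A decomposition of an object as a finite direct sum of simple objects. -/
structure SimpleDecomposition {D : Type u} [Category.{v} D] [Preadditive D] (X : D) where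
  {index : Type}
  [fintype : Fintype index]
  obj : index → D
  inc : ∀ a, obj a ⟶ X
  prj : ∀ a, X ⟶ obj a
  simple : ∀ a, Simple (obj a)
  inc_prj : ∀ a, inc a ≫ prj a = 𝟙 _
  inc_prj_ne : ∀ a b, a ≠ b → inc a ≫ prj b = 0
  total : ∑ a, prj a ≫ inc a = 𝟙 X

attribute [instance] SimpleDecomposition.fintype SimpleDecomposition.simple

namespace SimpleDecomposition

variable {D : Type u} [Category.{v} D] [Preadditive D]

/-- The decomposition given by a bilimit bicone. -/
def ofBicone {X : D} {n : ℕ} {S : Fin n → D} (b : Limits.Bicone S) (hS : ∀ i, Simple (S i))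
    (hb : b.IsBilimit) (e : X ≅ b.pt) : SimpleDecomposition X where
  obj := S
  inc a := b.ι a ≫ e.inv
  prj a := e.hom ≫ b.π a
  simple := hS
  inc_prj a := by simp
  inc_prj_ne a c h := by simp [bicone_ι_π_ne b h]
  total := by
    have h : ∑ a, b.π a ≫ b.ι a = 𝟙 b.pt := IsBilimit.total hb
    calc _ = e.hom ≫ (∑ a, b.π a ≫ b.ι a) ≫ e.inv := by
          simp [Preadditive.sum_comp, Preadditive.comp_sum]
      _ = _ := by simp [h]

/-- The decomposition of a simple object. -/
def ofSimple (X : D) [hX : Simple X] : SimpleDecomposition X where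
  index := Unit
  obj _ := X
  inc _ := 𝟙 X
  prj _ := 𝟙 X
  simple _ := hX
  inc_prj _ := by simp
  inc_prj_ne a b h := (h rfl).elim
  total := by simp

/-- The decomposition of a zero object. -/
def ofIsZero {X : D} (hX : IsZero X) : SimpleDecomposition X where
  index := Empty
  obj := Empty.elim
  inc a := a.elim
  prj a := a.elim
  simple a := a.elim
  inc_prj a := a.elim
  inc_prj_ne a := a.elim
  total := hX.eq_of_src _ _

/-- The decomposition of a direct sum. -/
def sum {X Y Z : D} (bY : SimpleDecomposition Y) (bZ : SimpleDecomposition Z) (i : Y ⟶ X)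
    (p : X ⟶ Y) (j : Z ⟶ X) (q : X ⟶ Z) (hi : i ≫ p = 𝟙 Y) (hj : j ≫ q = 𝟙 Z) (hij : i ≫ q = 0)
    (hji : j ≫ p = 0) (h : p ≫ i + q ≫ j = 𝟙 X) : SimpleDecomposition X where
  index := bY.index ⊕ bZ.index
  obj := Sum.elim bY.obj bZ.obj
  inc := fun
    | .inl a => bY.inc a ≫ i
    | .inr a => bZ.inc a ≫ j
  prj := fun
    | .inl a => p ≫ bY.prj a
    | .inr a => q ≫ bZ.prj a
  simple := fun
    | .inl a => bY.simple a
    | .inr a => bZ.simple a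
  inc_prj := fun
    | .inl a => by simp [reassoc_of% hi, bY.inc_prj]
    | .inr a => by simp [reassoc_of% hj, bZ.inc_prj]
  inc_prj_ne := fun
    | .inl a, .inl b, hab => by
      change (bY.inc a ≫ i) ≫ p ≫ bY.prj b = 0
      rw [Category.assoc, reassoc_of% hi, bY.inc_prj_ne a b (fun e => hab (congrArg _ e))]
    | .inl a, .inr b, _ => by
      change (bY.inc a ≫ i) ≫ q ≫ bZ.prj b = 0
      rw [Category.assoc, reassoc_of% hij, zero_comp, comp_zero]
    | .inr a, .inl b, _ => by
      change (bZ.inc a ≫ j) ≫ p ≫ bY.prj b = 0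
      rw [Category.assoc, reassoc_of% hji, zero_comp, comp_zero]
    | .inr a, .inr b, hab => by
      change (bZ.inc a ≫ j) ≫ q ≫ bZ.prj b = 0
      rw [Category.assoc, reassoc_of% hj, bZ.inc_prj_ne a b (fun e => hab (congrArg _ e))]
  total := by
    rw [Fintype.sum_sum_type, ← h]
    congr 1
    · calc _ = p ≫ (∑ a, bY.prj a ≫ bY.inc a) ≫ i := by
            simp [Preadditive.sum_comp, Preadditive.comp_sum]
        _ = _ := by simp [bY.total]
    · calc _ = q ≫ (∑ a, bZ.prj a ≫ bZ.inc a) ≫ j := by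
            simp [Preadditive.sum_comp, Preadditive.comp_sum]
        _ = _ := by simp [bZ.total]

lemma exists_bicone {X : D} (d : SimpleDecomposition X) :
    ∃ (n : ℕ) (S : Fin n → D) (b : Limits.Bicone S),
      (∀ i, Simple (S i)) ∧ Nonempty b.IsBilimit ∧ Nonempty (X ≅ b.pt) := by
  classical
  let e := (Fintype.equivFin d.index).symm
  let b : Limits.Bicone (fun i => d.obj (e i)) :=
    ⟨X, fun i => d.prj (e i), fun i => d.inc (e i), fun i j => by
      by_cases h : i = j
      · subst h; simp [d.inc_prj]
      · simp [h, d.inc_prj_ne _ _ (fun h' => h (e.injective h'))]⟩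
  refine ⟨_, _, b, fun i => d.simple _, ⟨isBilimitOfTotal b ?_⟩, ⟨Iso.refl _⟩⟩
  exact (Equiv.sum_comp e (fun a => d.prj a ≫ d.inc a)).trans d.total

lemma exists_inc_ne_zero {X Y : D} (d : SimpleDecomposition X) {f : X ⟶ Y} (hf : f ≠ 0) :
    ∃ a, d.inc a ≫ f ≠ 0 := by
  by_contra! h
  apply hf
  rw [← Category.id_comp f, ← d.total, Preadditive.sum_comp]
  simp [h]

lemma exists_iso_of_ne_zero [HasKernels D] {X Y : D} [Simple Y] (d : SimpleDecomposition X)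
    {f : X ⟶ Y} (hf : f ≠ 0) : ∃ a, IsIso (d.inc a ≫ f) := by
  obtain ⟨a, ha⟩ := d.exists_inc_ne_zero hf
  exact ⟨a, isIso_of_hom_simple ha⟩

end SimpleDecomposition

section Decomposition

variable {D : Type u} [Category.{v} D] [Preadditive D]

lemma exists_complement [IsIdempotentComplete D] {X Y : D} (i : Y ⟶ X)
    (p : X ⟶ Y) (hi : i ≫ p = 𝟙 Y) : ∃ (Z : D) (j : Z ⟶ X) (q : X ⟶ Z),
      j ≫ q = 𝟙 Z ∧ i ≫ q = 0 ∧ j ≫ p = 0 ∧ p ≫ i + q ≫ j = 𝟙 X := by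
  obtain ⟨Z, j, q, h1, h2⟩ := IsIdempotentComplete.idempotents_split X (𝟙 X - p ≫ i)
    (Idempotents.idem_of_id_sub_idem _ (by simp [reassoc_of% hi]))
  refine ⟨Z, j, q, h1, ?_, ?_, by rw [h2]; abel⟩
  · rw [← Category.comp_id q, ← h1, reassoc_of% h2]
    simp [reassoc_of% hi]
  · rw [← Category.id_comp j, ← h1, Category.assoc, Category.assoc, reassoc_of% h2]
    simp [hi]

variable (F : Type w) [Field F] [Linear F D]

/-- End(Y) embeds in End(X) by a ↦ p ≫ a ≫ i, and the image misses the idempotent of the nonzero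
complement Z. -/
lemma finrank_end_lt [∀ X Y : D, Module.Finite F (X ⟶ Y)] {X Y Z : D} (i : Y ⟶ X) (p : X ⟶ Y)
    (j : Z ⟶ X) (q : X ⟶ Z) (hi : i ≫ p = 𝟙 Y) (hj : j ≫ q = 𝟙 Z) (hij : i ≫ q = 0)
    (hZ : ¬ IsZero Z) : Module.finrank F (Y ⟶ Y) < Module.finrank F (X ⟶ X) := by
  let φ : (Y ⟶ Y) →ₗ[F] (X ⟶ X) := (Linear.leftComp F X p) ∘ₗ (Linear.rightComp F Y i)
  have hφ (a) : φ a = p ≫ a ≫ i := rfl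
  have hinj : Function.Injective φ := fun a b h => by
    have := congrArg (fun t => i ≫ t ≫ p) h
    simpa [hφ, hi, reassoc_of% hi] using this
  rw [← LinearMap.finrank_range_of_inj hinj]
  apply Submodule.finrank_lt
  intro htop
  have hmem : q ≫ j ∈ LinearMap.range φ := htop ▸ Submodule.mem_top
  obtain ⟨a, ha⟩ := hmem
  apply hZ
  rw [IsZero.iff_id_eq_zero]
  have := congrArg (fun t => j ≫ t ≫ q) ha
  simp only [hφ, Category.assoc, hij, comp_zero, hj, Category.comp_id] at this
  exact this.symm

lemma HasGeneralizedInverses.nonempty_simpleDecomposition [IsIdempotentComplete D]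
    [∀ X Y : D, Module.Finite F (X ⟶ Y)] (hD : HasGeneralizedInverses D) (X : D) :
    Nonempty (SimpleDecomposition X) := by
  induction hn : Module.finrank F (X ⟶ X) using Nat.strong_induction_on generalizing X with
  | _ n ih =>
  by_cases h0 : IsZero X
  · exact ⟨.ofIsZero h0⟩
  by_cases hs : Simple X
  · exact ⟨.ofSimple X⟩
  -- A nonzero object that is not simple has a proper nonzero subobject. It splits off, and both
  -- summands have smaller endomorphism spaces.
  obtain ⟨Y, f, hm, hf⟩ : ∃ (Y : D) (f : Y ⟶ X) (_ : Mono f), ¬ (IsIso f ↔ f ≠ 0) := by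
    by_contra! h
    exact hs ⟨fun f _ => h _ f inferInstance⟩
  have hiso : ¬ IsIso f := fun h => hf ⟨fun _ h' => h0 (by
    rw [IsZero.iff_id_eq_zero, ← IsIso.inv_hom_id f]
    exact (congrArg (fun t => inv f ≫ t) h').trans comp_zero), fun _ => h⟩
  have hne : f ≠ 0 := fun h => hf ⟨fun h' => (hiso h').elim, fun h' => (h' h).elim⟩
  obtain ⟨p, hp⟩ := hD.exists_retraction f
  obtain ⟨Z, j, q, hj, hij, hji, ht⟩ := exists_complement f p hp
  have hZ : ¬ IsZero Z := fun hZ => hiso ⟨p, hp, by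
    rw [← ht, hZ.eq_of_tgt q 0, zero_comp, add_zero]⟩
  have hY : ¬ IsZero Y := fun hY => hne (hY.eq_of_src _ _)
  obtain ⟨bY⟩ := ih _ (hn ▸ finrank_end_lt F f p j q hp hj hij hZ) Y rfl
  obtain ⟨bZ⟩ := ih _ (hn ▸ finrank_end_lt F j q f p hj hp hji hY) Z rfl
  exact ⟨bY.sum bZ f p j q hp hj hij hji ht⟩

end Decomposition

/-! ### Generalized inverses in a semisimple abelian category -/

section Semisimple

variable {C : Type u} [Category.{v} C] [Abelian C]

/-- The pullback of an epimorphism along S surjects onto S, so by Schur's lemma one of its simple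
summands maps isomorphically. The inverse of this isomorphism gives the lift. -/
lemma projective_of_simple (hC : ∀ X : C, Nonempty (SimpleDecomposition X)) (S : C) [Simple S] :
    Projective S := by
  constructor
  intro E X f e he
  obtain ⟨d⟩ := hC (pullback e f)
  have hne : pullback.snd e f ≠ 0 := fun h => by
    have : Epi (0 : pullback e f ⟶ S) := h ▸ inferInstance
    exact id_nonzero S ((cancel_epi (0 : pullback e f ⟶ S)).1 (by simp))
  obtain ⟨a, ha⟩ := d.exists_iso_of_ne_zero hne
  refine ⟨inv (d.inc a ≫ pullback.snd e f) ≫ d.inc a ≫ pullback.fst e f, ?_⟩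
  rw [Category.assoc, Category.assoc, pullback.condition, IsIso.inv_comp_eq, Category.assoc]

lemma projective_of_decomposition (hC : ∀ X : C, Nonempty (SimpleDecomposition X)) (X : C) :
    Projective X := by
  obtain ⟨d⟩ := hC X
  constructor
  intro E Y f e he
  have (a : d.index) := projective_of_simple hC (d.obj a)
  refine ⟨∑ a, d.prj a ≫ Projective.factorThru (d.inc a ≫ f) e, ?_⟩
  have h : f = ∑ a, (d.prj a ≫ d.inc a) ≫ f := by
    rw [← Preadditive.sum_comp, d.total, Category.id_comp]
  rw [Preadditive.sum_comp]
  conv_rhs => rw [h]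
  simp

/-- All objects are projective, so both halves of the image factorization of f split, and the
splittings compose to a generalized inverse. -/
lemma hasGeneralizedInverses_of_decomposition (hC : ∀ X : C, Nonempty (SimpleDecomposition X)) :
    HasGeneralizedInverses C := by
  have hp := projective_of_decomposition hC
  have hm {X Y : C} (m : X ⟶ Y) [Mono m] : ∃ r : Y ⟶ X, m ≫ r = 𝟙 X := by
    let s := Projective.factorThru (𝟙 _) (cokernel.π m)
    have hs : s ≫ cokernel.π m = 𝟙 _ := Projective.factorThru_comp _ _
    have h0 : (𝟙 Y - cokernel.π m ≫ s) ≫ cokernel.π m = 0 := by simp [hs]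
    refine ⟨Abelian.monoLift m _ h0, ?_⟩
    rw [← cancel_mono m, Category.assoc, Abelian.monoLift_comp]
    simp
  intro X Y f
  obtain ⟨r, hr⟩ := hm (image.ι f)
  let s := Projective.factorThru (𝟙 _) (factorThruImage f)
  have hs : s ≫ factorThruImage f = 𝟙 _ := Projective.factorThru_comp _ _
  refine ⟨r ≫ s, ?_⟩
  have hf := image.fac f
  calc f ≫ (r ≫ s) ≫ f = factorThruImage f ≫ (image.ι f ≫ r) ≫ (s ≫ factorThruImage f) ≫
        image.ι f := by
        simp only [Category.assoc, hf]
        rw [← Category.assoc (factorThruImage f), hf]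
    _ = f := by rw [hr, hs, Category.id_comp, Category.id_comp, hf]

end Semisimple

/-! ### Idempotents, direct sums, averaging and free modules -/

namespace Mod

section Retract

variable {C : Type u} [Category.{v} C] [MonoidalCategory C] {Γ : C} [MonObj Γ]

/-- The module structure on a retract of a module whose idempotent is a module morphism. -/
def ofRetract {M : Mod C Γ} {p : M ⟶ M} {Y : C} {i : Y ⟶ M.X} {e : M.X ⟶ Y}
    (h₁ : i ≫ e = 𝟙 Y) (h₂ : e ≫ i = p.hom) : Mod C Γ :=
  ofAct Y (Γ ◁ i ≫ M.act ≫ e)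
    (by rw [← whisker_exchange_assoc, reassoc_of% M.one_act, leftUnitor_naturality_assoc, h₁,
      Category.comp_id])
    (by
      have h : M.act ≫ e ≫ i = Γ ◁ e ≫ Γ ◁ i ≫ M.act := by
        rw [← MonoidalCategory.whiskerLeft_comp_assoc, h₂, act_hom]
      have h' : M.act ≫ e = Γ ◁ e ≫ Γ ◁ i ≫ M.act ≫ e := by
        rw [← reassoc_of% h, h₁, Category.comp_id]
      rw [← whisker_exchange_assoc, reassoc_of% M.mul_act]
      nth_rewrite 1 [h']
      simp)

instance [IsIdempotentComplete C] : IsIdempotentComplete (Mod C Γ) where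
  idempotents_split M p hp := by
    obtain ⟨Y, i, e, h₁, h₂⟩ := IsIdempotentComplete.idempotents_split M.X p.hom
      (by rw [← comp_hom', hp])
    have h : M.act ≫ e ≫ i = Γ ◁ e ≫ Γ ◁ i ≫ M.act := by
      rw [← MonoidalCategory.whiskerLeft_comp_assoc, h₂, act_hom]
    refine ⟨ofRetract h₁ h₂, homOfAct i ?_, homOfAct e ?_, Mod.hom_ext _ _ h₁, Mod.hom_ext _ _ h₂⟩
    · have h' : (Γ ◁ i ≫ M.act ≫ e) ≫ i = Γ ◁ i ≫ M.act := by
        rw [Category.assoc, Category.assoc, h, ← MonoidalCategory.whiskerLeft_comp_assoc, h₁]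
        simp
      exact h'
    · change M.act ≫ e = Γ ◁ e ≫ Γ ◁ i ≫ M.act ≫ e
      rw [← reassoc_of% h, h₁, Category.comp_id]

end Retract

section Additive

variable {C : Type u} [Category.{v} C] [Preadditive C] [MonoidalCategory C]
  {Γ : C} [MonObj Γ]

/-- The action on the direct sum of two modules. -/
noncomputable def biprodAct [HasBinaryBiproducts C] (M N : Mod C Γ) :
    Γ ⊗ (M.X ⊞ N.X) ⟶ M.X ⊞ N.X :=
  Γ ◁ biprod.fst ≫ M.act ≫ biprod.inl + Γ ◁ biprod.snd ≫ N.act ≫ biprod.inr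

lemma biprodAct_fst [HasBinaryBiproducts C] (M N : Mod C Γ) :
    biprodAct M N ≫ biprod.fst = Γ ◁ biprod.fst ≫ M.act := by
  simp [biprodAct]

lemma biprodAct_snd [HasBinaryBiproducts C] (M N : Mod C Γ) :
    biprodAct M N ≫ biprod.snd = Γ ◁ biprod.snd ≫ N.act := by
  simp [biprodAct]

variable [MonoidalPreadditive C]

open ZeroObject in
instance [HasZeroObject C] : HasZeroObject (Mod C Γ) :=
  ⟨ofAct (0 : C) 0 ((isZero_zero C).eq_of_tgt _ _) ((isZero_zero C).eq_of_tgt _ _),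
    (IsZero.iff_id_eq_zero _).2 (Mod.hom_ext _ _ ((isZero_zero C).eq_of_tgt _ _))⟩

lemma inl_biprodAct [HasBinaryBiproducts C] (M N : Mod C Γ) :
    M.act ≫ biprod.inl = Γ ◁ biprod.inl ≫ biprodAct M N := by
  simp [biprodAct, ← MonoidalCategory.whiskerLeft_comp_assoc, Preadditive.comp_add]

lemma inr_biprodAct [HasBinaryBiproducts C] (M N : Mod C Γ) :
    N.act ≫ biprod.inr = Γ ◁ biprod.inr ≫ biprodAct M N := by
  simp [biprodAct, ← MonoidalCategory.whiskerLeft_comp_assoc, Preadditive.comp_add]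

/-- The direct sum of two modules. -/
noncomputable def biprod [HasBinaryBiproducts C] (M N : Mod C Γ) : Mod C Γ :=
  ofAct (M.X ⊞ N.X) (biprodAct M N)
    (by
      apply biprod.hom_ext
      · rw [Category.assoc, biprodAct_fst, ← whisker_exchange_assoc, M.one_act,
          leftUnitor_naturality]
      · rw [Category.assoc, biprodAct_snd, ← whisker_exchange_assoc, N.one_act,
          leftUnitor_naturality])
    (by
      apply biprod.hom_ext
      · simp only [Category.assoc, biprodAct_fst]
        rw [← whisker_exchange_assoc, M.mul_act, ← MonoidalCategory.whiskerLeft_comp_assoc,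
          biprodAct_fst]
        simp
      · simp only [Category.assoc, biprodAct_snd]
        rw [← whisker_exchange_assoc, N.mul_act, ← MonoidalCategory.whiskerLeft_comp_assoc,
          biprodAct_snd]
        simp)

/-- The direct sum of two modules as a bicone. -/
noncomputable def biprodBicone [HasBinaryBiproducts C] (M N : Mod C Γ) : BinaryBicone M N where
  pt := biprod M N
  fst := homOfAct biprod.fst (biprodAct_fst M N)
  snd := homOfAct biprod.snd (biprodAct_snd M N)
  inl := homOfAct biprod.inl (inl_biprodAct M N)
  inr := homOfAct biprod.inr (inr_biprodAct M N)
  inl_fst := Mod.hom_ext _ _ biprod.inl_fst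
  inl_snd := Mod.hom_ext _ _ biprod.inl_snd
  inr_fst := Mod.hom_ext _ _ biprod.inr_fst
  inr_snd := Mod.hom_ext _ _ biprod.inr_snd

instance [HasBinaryBiproducts C] : HasBinaryBiproducts (Mod C Γ) where
  has_binary_biproduct M N :=
    hasBinaryBiproduct_of_total (biprodBicone M N) (Mod.hom_ext _ _ biprod.total)

end Additive

section GeneralizedInverses

variable {C : Type u} [Category.{v} C] [MonoidalCategory C] {Γ : C} [MonObj Γ]

/-- The module morphism obtained by averaging a morphism of the underlying objects. -/
def average (S : SeparableFrobenius Γ) {M N : Mod C Γ} (g : M.X ⟶ N.X) : M ⟶ N :=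
  homOfAct (S.coact M ≫ Γ ◁ g ≫ N.act) (by
    rw [reassoc_of% S.act_coact M, ← whisker_exchange_assoc, N.mul_act]
    simp)

/-- Maschke: averaging commutes with composition by module maps, so f, the average of g, and f
compose to the average of fgf = f, which is f by separability. -/
lemma hasGeneralizedInverses (S : SeparableFrobenius Γ) (hC : HasGeneralizedInverses C) :
    HasGeneralizedInverses (Mod C Γ) := by
  intro M N f
  obtain ⟨g, hg⟩ := hC f.hom
  refine ⟨average S g, Mod.hom_ext _ _ ?_⟩
  rw [comp_hom', comp_hom']
  change f.hom ≫ (S.coact N ≫ Γ ◁ g ≫ M.act) ≫ f.hom = f.hom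
  simp only [Category.assoc]
  rw [act_hom, ← reassoc_of% S.coact_map f, ← MonoidalCategory.whiskerLeft_comp_assoc,
    ← MonoidalCategory.whiskerLeft_comp_assoc, Category.assoc, hg, ← act_hom,
    reassoc_of% S.coact_act M]

end GeneralizedInverses

section FiniteHom

variable (F : Type w) [Field F] {C : Type u} [Category.{v} C] [Preadditive C] [Linear F C]
  [MonoidalCategory C] [MonoidalPreadditive C] [MonoidalLinear F C] {Γ : C} [MonObj Γ]

/-- The underlying morphism, as a linear map. -/
def homLinearMap (M N : Mod C Γ) : (M ⟶ N) →ₗ[F] (M.X ⟶ N.X) where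
  toFun f := f.hom
  map_add' _ _ := rfl
  map_smul' _ _ := rfl

lemma finite_hom (M N : Mod C Γ) [Module.Finite F (M.X ⟶ N.X)] : Module.Finite F (M ⟶ N) :=
  Module.Finite.of_injective (homLinearMap F M N) (fun _ _ h => Mod.hom_ext _ _ h)

end FiniteHom

section Free

variable {C : Type u} [Category.{v} C] [MonoidalCategory C] (Γ : C) [MonObj Γ]

/-- The free module on an object. -/
def free (X : C) : Mod C Γ :=
  ofAct (Γ ⊗ X) ((α_ _ _ _).inv ≫ μ[Γ] ▷ X)
    (by rw [associator_inv_naturality_left_assoc, ← comp_whiskerRight, MonObj.one_mul]; simp)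
    (by
      rw [associator_inv_naturality_left_assoc, ← comp_whiskerRight, MonObj.mul_assoc]
      simp)

/-- The inclusion of the generators of a free module. -/
def freeGen (X : C) : X ⟶ (free Γ X).X := (λ_ X).inv ≫ η[Γ] ▷ X

variable {Γ}

lemma freeExtend_linear {X : C} {M : Mod C Γ} (g : X ⟶ M.X) :
    ((α_ _ _ _).inv ≫ μ[Γ] ▷ X) ≫ Γ ◁ g ≫ M.act = Γ ◁ (Γ ◁ g ≫ M.act) ≫ M.act := by
  rw [Category.assoc, ← whisker_exchange_assoc, M.mul_act]
  simp

lemma one_freeExtend {X : C} {M : Mod C Γ} (g : X ⟶ M.X) :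
    ((λ_ X).inv ≫ η[Γ] ▷ X) ≫ Γ ◁ g ≫ M.act = g := by
  rw [Category.assoc, ← whisker_exchange_assoc, M.one_act]
  simp

lemma linear_eq_freeExtend {X : C} {M : Mod C Γ} (f : Γ ⊗ X ⟶ M.X)
    (h : ((α_ Γ Γ X).inv ≫ μ[Γ] ▷ X) ≫ f = Γ ◁ f ≫ M.act) :
    Γ ◁ (((λ_ X).inv ≫ η[Γ] ▷ X) ≫ f) ≫ M.act = f := by
  rw [MonoidalCategory.whiskerLeft_comp_assoc, ← h, MonoidalCategory.whiskerLeft_comp]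
  simp only [Category.assoc]
  rw [associator_inv_naturality_middle_assoc, ← comp_whiskerRight_assoc, MonObj.mul_one]
  simp

/-- The module morphism from a free module that extends a morphism. -/
def freeExtend {X : C} {M : Mod C Γ} (g : X ⟶ M.X) : free Γ X ⟶ M :=
  homOfAct (M := free Γ X) (Γ ◁ g ≫ M.act) (freeExtend_linear g)

variable (Γ) (F : Type w) [Field F] [Preadditive C] [Linear F C] [MonoidalPreadditive C]
  [MonoidalLinear F C]

/-- Morphisms from a free module. -/
def freeHomEquiv (X : C) (M : Mod C Γ) : (free Γ X ⟶ M) ≃ₗ[F] (X ⟶ M.X) where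
  toFun f := freeGen Γ X ≫ f.hom
  invFun := freeExtend
  left_inv f := Mod.hom_ext _ _ (linear_eq_freeExtend (M := M) f.hom (act_hom f))
  right_inv := one_freeExtend
  map_add' f g := by rw [add_hom, Preadditive.comp_add]
  map_smul' c f := by rw [smul_hom, Linear.comp_smul, RingHom.id_apply]

end Free

end Mod

/-! ### Multiplicities of simple objects -/

namespace SimpleClass

variable {D : Type u} [Category.{v} D] [HasZeroMorphisms D]

instance (c : SimpleClass D) : Simple c.rep :=
  (_root_.Quotient.out (s := simpleSetoid D) c).property

/-- The isomorphism class of a simple object. -/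
def mk (X : D) [hX : Simple X] : SimpleClass D :=
  _root_.Quotient.mk (simpleSetoid D) ⟨X, hX⟩

lemma mk_eq_mk_iff {X Y : D} [Simple X] [Simple Y] : mk X = mk Y ↔ Nonempty (X ≅ Y) :=
  _root_.Quotient.eq (r := simpleSetoid D)

lemma mk_rep (c : SimpleClass D) : mk c.rep = c :=
  _root_.Quotient.out_eq (s := simpleSetoid D) c

lemma mk_eq_iff {X : D} [Simple X] {c : SimpleClass D} : mk X = c ↔ Nonempty (X ≅ c.rep) := by
  rw [← mk_eq_mk_iff, mk_rep]

end SimpleClass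

namespace SimpleDecomposition

open scoped Classical in
lemma sum_mul_eq {D : Type u} [Category.{v} D] [Preadditive D] {F : Type w} [Field F]
    [Fintype (SimpleClass D)] {X : D} (d : SimpleDecomposition X) (δ : D → F)
    (hδ : ∀ {Y Z : D}, (Y ≅ Z) → δ Y = δ Z) :
    ∑ c : SimpleClass D, ((∑ a, if SimpleClass.mk (d.obj a) = c then 1 else 0 : ℕ) : F) * δ c.rep =
      ∑ a, δ (d.obj a) := by
  simp only [Nat.cast_sum, Nat.cast_ite, Nat.cast_one, Nat.cast_zero, Finset.sum_mul]
  rw [Finset.sum_comm]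
  refine Finset.sum_congr rfl fun a _ => ?_
  simp only [ite_mul, one_mul, zero_mul, Finset.sum_ite_eq, Finset.mem_univ, if_true]
  obtain ⟨e⟩ := SimpleClass.mk_eq_iff.1 (rfl : SimpleClass.mk (d.obj a) = _)
  exact (hδ e).symm

variable {D : Type u} [Category.{v} D] [Preadditive D] (F : Type w) [Field F] [Linear F D]

/-- Morphisms to a direct sum. -/
def homEquiv {X : D} (d : SimpleDecomposition X) (T : D) :
    (T ⟶ X) ≃ₗ[F] (∀ a, T ⟶ d.obj a) where
  toFun f a := f ≫ d.prj a
  invFun g := ∑ a, g a ≫ d.inc a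
  left_inv f := by
    simp only [Category.assoc]
    rw [← Preadditive.comp_sum, d.total, Category.comp_id]
  right_inv g := by
    funext b
    dsimp only
    rw [Preadditive.sum_comp, Finset.sum_eq_single b]
    · rw [Category.assoc, d.inc_prj, Category.comp_id]
    · intro a _ hab
      rw [Category.assoc, d.inc_prj_ne _ _ hab, comp_zero]
    · simp
  map_add' f g := by funext a; exact Preadditive.add_comp _ _ _ _ _ _
  map_smul' c f := by funext a; exact Linear.smul_comp _ _ _ _ _ _

/-- Morphisms from a direct sum. -/
def homEquiv' {X : D} (d : SimpleDecomposition X) (T : D) :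
    (X ⟶ T) ≃ₗ[F] (∀ a, d.obj a ⟶ T) where
  toFun f a := d.inc a ≫ f
  invFun g := ∑ a, d.prj a ≫ g a
  left_inv f := by
    simp only [← Category.assoc]
    rw [← Preadditive.sum_comp, d.total, Category.id_comp]
  right_inv g := by
    funext b
    dsimp only
    rw [Preadditive.comp_sum, Finset.sum_eq_single b]
    · rw [reassoc_of% d.inc_prj]
    · intro a _ hab
      rw [reassoc_of% (d.inc_prj_ne _ _ hab.symm), zero_comp]
    · simp
  map_add' f g := by funext a; exact Preadditive.comp_add _ _ _ _ _ _
  map_smul' c f := by funext a; exact Linear.comp_smul _ _ _ _ _ _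

variable [IsAlgClosed F] [HasKernels D] [∀ X Y : D, Module.Finite F (X ⟶ Y)]

open scoped Classical in
-- By Schur's lemma over an algebraically closed field, each summand contributes 1 or 0.
lemma finrank_rep_hom {X : D} (d : SimpleDecomposition X) (c : SimpleClass D) :
    Module.finrank F (c.rep ⟶ X) = ∑ a, if SimpleClass.mk (d.obj a) = c then 1 else 0 := by
  rw [(d.homEquiv F c.rep).finrank_eq, Module.finrank_pi_fintype]
  refine Finset.sum_congr rfl fun a _ => ?_
  rw [finrank_hom_simple_simple]
  simp only [SimpleClass.mk_eq_iff]
  exact if_congr ⟨fun ⟨e⟩ => ⟨e.symm⟩, fun ⟨e⟩ => ⟨e.symm⟩⟩ rfl rfl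

open scoped Classical in
lemma finrank_hom_rep {X : D} (d : SimpleDecomposition X) (c : SimpleClass D) :
    Module.finrank F (X ⟶ c.rep) = ∑ a, if SimpleClass.mk (d.obj a) = c then 1 else 0 := by
  rw [(d.homEquiv' F c.rep).finrank_eq, Module.finrank_pi_fintype]
  refine Finset.sum_congr rfl fun a _ => ?_
  rw [finrank_hom_simple_simple]
  simp only [SimpleClass.mk_eq_iff]

variable {F} [Fintype (SimpleClass D)]

lemma sum_finrank_rep_hom {X : D} (d : SimpleDecomposition X) (δ : D → F)
    (hδ : ∀ {Y Z : D}, (Y ≅ Z) → δ Y = δ Z) :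
    ∑ c : SimpleClass D, (Module.finrank F (c.rep ⟶ X) : F) * δ c.rep = ∑ a, δ (d.obj a) := by
  classical
  rw [← d.sum_mul_eq δ hδ]
  refine Finset.sum_congr rfl fun c _ => ?_
  rw [d.finrank_rep_hom F c]

lemma sum_finrank_hom_rep {X : D} (d : SimpleDecomposition X) (δ : D → F)
    (hδ : ∀ {Y Z : D}, (Y ≅ Z) → δ Y = δ Z) :
    ∑ c : SimpleClass D, (Module.finrank F (X ⟶ c.rep) : F) * δ c.rep = ∑ a, δ (d.obj a) := by
  classical
  rw [← d.sum_mul_eq δ hδ]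
  refine Finset.sum_congr rfl fun c _ => ?_
  rw [d.finrank_hom_rep F c]

end SimpleDecomposition

/-! ### Additivity and multiplicativity of the ribbon dimension -/

section RibbonDim

open RibbonCategory

variable {F : Type w} [Field F] {C : Type u} [Category.{v} C] [Preadditive C] [Linear F C]
  [MonoidalCategory C] [BraidedCategory C] [RightRigidCategory C] [RibbonCategory C]

lemma ribbonDim_iso {X Y : C} (e : X ≅ Y) : ribbonDim F X = ribbonDim F Y := by
  rw [ribbonDim, ribbonDim, ← e.hom_inv_id, ribbonTrace_comm, e.inv_hom_id]

variable [MonoidalPreadditive C]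

lemma ribbonTrace_sum {J : Type*} [Fintype J] {X : C} (f : J → (X ⟶ X)) :
    ribbonTrace (∑ a, f a) = ∑ a, ribbonTrace (f a) := by
  simp only [ribbonTrace_eq, sum_whiskerRight, Preadditive.sum_comp, Preadditive.comp_sum]

lemma ribbonDim_eq_sum (h : Function.Bijective (fun c : F => c • 𝟙 (𝟙_ C))) {J : Type*} [Fintype J]
    {X : C} {Y : J → C} (i : ∀ a, Y a ⟶ X) (p : ∀ a, X ⟶ Y a) (hip : ∀ a, i a ≫ p a = 𝟙 _)
    (hpi : ∑ a, p a ≫ i a = 𝟙 X) : ribbonDim F X = ∑ a, ribbonDim F (Y a) := by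
  apply h.1
  dsimp only
  rw [ribbonDim, smul_unitScalar_id h, Finset.sum_smul, ← hpi, ribbonTrace_sum]
  refine Finset.sum_congr rfl fun a _ => ?_
  rw [ribbonDim, smul_unitScalar_id h, ribbonTrace_comm, hip]

variable [MonoidalLinear F C]

/-- The loop of Y lies inside the loop of X, and being a scalar it can be pulled out. -/
lemma ribbonDim_tensor (h : Function.Bijective (fun c : F => c • 𝟙 (𝟙_ C))) (X Y : C) :
    ribbonDim F (X ⊗ Y) = ribbonDim F X * ribbonDim F Y := by
  apply h.1
  dsimp only
  have hY : ribbonTrace (𝟙 Y) = ribbonDim F Y • 𝟙 (𝟙_ C) := (smul_unitScalar_id h _).symm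
  have hX : η_ X Xᘁ ≫ revEv X Xᘁ = ribbonDim F X • 𝟙 (𝟙_ C) := by
    rw [ribbonDim, smul_unitScalar_id h, ribbonTrace_eq]
    simp
  have hXY : ribbonTrace (𝟙 (X ⊗ Y)) = ribbonDim F (X ⊗ Y) • 𝟙 (𝟙_ C) :=
    (smul_unitScalar_id h _).symm
  rw [← hXY, ribbonTrace_id_tensor, hY, MonoidalLinear.smul_whiskerRight, Linear.smul_comp,
    Linear.comp_smul, MonoidalLinear.whiskerLeft_smul, Linear.smul_comp, Linear.comp_smul,
    mul_comm, mul_smul, ← hX]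
  simp

end RibbonDim

namespace IsSemisimpleTensorCategory

variable {F : Type w} [Field F] {D : Type u} [Category.{v} D] [Preadditive D] [Linear F D]
  [MonoidalCategory D]

lemma nonempty_simpleDecomposition (h : IsSemisimpleTensorCategory F D) (X : D) :
    Nonempty (SimpleDecomposition X) := by
  obtain ⟨n, S, b, hS, ⟨hb⟩, ⟨e⟩⟩ := h.semisimple X
  exact ⟨.ofBicone b hS hb e⟩

end IsSemisimpleTensorCategory

/-! ### Finiteness of simple modules and the global dimension -/

namespace Mod

section Finite

variable {C : Type u} [Category.{v} C] [Preadditive C] [MonoidalCategory C]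
  [MonoidalPreadditive C] {Γ : C} [MonObj Γ]

lemma isZero_of_isZero_X {M : Mod C Γ} (h : IsZero M.X) : IsZero M :=
  (IsZero.iff_id_eq_zero _).2 (Mod.hom_ext _ _ (h.eq_of_src _ _))

lemma freeExtend_ne_zero {X : C} {M : Mod C Γ} {g : X ⟶ M.X} (hg : g ≠ 0) : freeExtend g ≠ 0 := by
  intro h
  apply hg
  have h1 : Γ ◁ g ≫ M.act = 0 := congrArg Mod.Hom.hom h
  rw [← one_freeExtend g, h1, comp_zero]

/-- Every simple module is a direct summand of a free module on a simple object. -/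
lemma finite_simpleClass [HasKernels (Mod C Γ)]
    (hC : ∀ X : C, Nonempty (SimpleDecomposition X))
    (hM : ∀ M : Mod C Γ, Nonempty (SimpleDecomposition M)) [Finite (SimpleClass C)] :
    Finite (SimpleClass (Mod C Γ)) := by
  let d (c : SimpleClass C) : SimpleDecomposition (free Γ c.rep) := (hM _).some
  let φ : (Σ c : SimpleClass C, (d c).index) → SimpleClass (Mod C Γ) :=
    fun x => SimpleClass.mk ((d x.1).obj x.2)
  refine Finite.of_surjective φ fun y => ?_
  obtain ⟨dX⟩ := hC y.rep.X
  have h0 : 𝟙 y.rep.X ≠ 0 := fun h =>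
    Simple.not_isZero y.rep (isZero_of_isZero_X ((IsZero.iff_id_eq_zero _).2 h))
  obtain ⟨a, ha⟩ := dX.exists_inc_ne_zero h0
  rw [Category.comp_id] at ha
  obtain ⟨e⟩ := SimpleClass.mk_eq_iff.1 (rfl : SimpleClass.mk (dX.obj a) = _)
  have hg : e.inv ≫ dX.inc a ≠ 0 := fun h => ha (by
    rw [← cancel_epi e.inv, h, comp_zero])
  -- A simple X occurring in the simple module gives a nonzero map to it from the free module on X;
  -- by Schur's lemma the module is a summand of that free module.
  obtain ⟨b, hb⟩ := (d (SimpleClass.mk (dX.obj a))).exists_iso_of_ne_zero (freeExtend_ne_zero hg)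
  exact ⟨⟨SimpleClass.mk (dX.obj a), b⟩,
    SimpleClass.mk_eq_iff.2 ⟨@asIso _ _ _ _ _ hb⟩⟩

end Finite

section Dimension

variable {F : Type w} [Field F] [IsAlgClosed F] {C : Type u} [Category.{v} C] [Preadditive C]
  [Linear F C] [MonoidalCategory C] [MonoidalPreadditive C] [MonoidalLinear F C]
  [BraidedCategory C] [RightRigidCategory C] [RibbonCategory C] {Γ : C} [MonObj Γ]

/-- One factor d(Y) is expanded over the simple objects of `C` (`h1`). After the sums are exchanged,
the adjunction between free and underlying objects makes the inner sum the decomposition of d(Γ ⊗ X)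
(`h3`). -/
lemma sum_sq_ribbonDim [HasKernels C] [HasKernels (Mod C Γ)]
    [∀ X Y : C, Module.Finite F (X ⟶ Y)]
    (hC : ∀ X : C, Nonempty (SimpleDecomposition X))
    (hM : ∀ M : Mod C Γ, Nonempty (SimpleDecomposition M))
    [Fintype (SimpleClass C)] [Fintype (SimpleClass (Mod C Γ))]
    (hunit : Function.Bijective (fun c : F => c • 𝟙 (𝟙_ C))) :
    ∑ y : SimpleClass (Mod C Γ), ribbonDim F y.rep.X ^ 2 =
      ribbonDim F Γ * ∑ c : SimpleClass C, ribbonDim F c.rep ^ 2 := by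
  have (M N : Mod C Γ) : Module.Finite F (M ⟶ N) := finite_hom F M N
  have h1 (X : C) : ∑ c : SimpleClass C, (Module.finrank F (c.rep ⟶ X) : F) * ribbonDim F c.rep =
      ribbonDim F X := by
    obtain ⟨d⟩ := hC X
    rw [d.sum_finrank_rep_hom _ ribbonDim_iso,
      ribbonDim_eq_sum hunit d.inc d.prj d.inc_prj d.total]
  have h2 (M : Mod C Γ) : ∑ y : SimpleClass (Mod C Γ),
      (Module.finrank F (M ⟶ y.rep) : F) * ribbonDim F y.rep.X = ribbonDim F M.X := by
    obtain ⟨d⟩ := hM M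
    rw [d.sum_finrank_hom_rep (fun N => ribbonDim F N.X) (fun e => ribbonDim_iso
      ⟨e.hom.hom, e.inv.hom, by rw [← comp_hom', e.hom_inv_id, id_hom'],
        by rw [← comp_hom', e.inv_hom_id, id_hom']⟩)]
    refine (ribbonDim_eq_sum hunit (fun a => (d.inc a).hom) (fun a => (d.prj a).hom)
      (fun a => ?_) ?_).symm
    · rw [← comp_hom', d.inc_prj, id_hom']
    · have h := congrArg (homLinearMap F M M) d.total
      rw [map_sum] at h
      exact h
  have h3 (c : SimpleClass C) : ∑ y : SimpleClass (Mod C Γ),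
      (Module.finrank F (c.rep ⟶ y.rep.X) : F) * ribbonDim F y.rep.X =
        ribbonDim F Γ * ribbonDim F c.rep := by
    rw [← ribbonDim_tensor hunit]
    refine Eq.trans ?_ (h2 (free Γ c.rep))
    refine Finset.sum_congr rfl fun y _ => ?_
    rw [(freeHomEquiv Γ F c.rep y.rep).finrank_eq]
  calc _ = ∑ y : SimpleClass (Mod C Γ), ∑ c : SimpleClass C,
        ribbonDim F c.rep * ((Module.finrank F (c.rep ⟶ y.rep.X) : F) * ribbonDim F y.rep.X) := by
        refine Finset.sum_congr rfl fun y _ => ?_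
        rw [pow_two]
        nth_rewrite 1 [← h1 y.rep.X]
        rw [Finset.sum_mul]
        exact Finset.sum_congr rfl fun c _ => by ring
    _ = ∑ c : SimpleClass C, ribbonDim F c.rep * (ribbonDim F Γ * ribbonDim F c.rep) := by
        rw [Finset.sum_comm]
        refine Finset.sum_congr rfl fun c _ => ?_
        rw [← Finset.mul_sum, h3]
    _ = _ := by
        rw [Finset.mul_sum]
        exact Finset.sum_congr rfl fun c _ => by ring

end Dimension

end Mod

end CategoryTheory

/-! ### Proof of the theorem -/

theorem mainTheorem9 {F : Type w} [Field F] [IsAlgClosed F]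
    {C : Type u} [Category.{v} C] [Abelian C] [Linear F C]
    [MonoidalCategory C] [MonoidalPreadditive C] [MonoidalLinear F C]
    [BraidedCategory C] [RigidCategory C] [RibbonCategory C]
    (hC : IsSemisimpleTensorCategory F C) (hfin : Finite (SimpleClass C))
    (Γ : C) [MonObj Γ] [ComonObj Γ] [IsCommMonObj Γ]
    (hΓ : IsStronglySeparableFrobenius F Γ)
    (hunit : Module.finrank F (𝟙_ C ⟶ Γ) = 1)
    (hdim : ribbonDim F Γ ≠ 0) :
    IsSemisimpleTensorCategory F (Mod C Γ) ∧
    Finite (SimpleClass (Mod C Γ)) ∧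
    ∃ (_ : RightRigidCategory (Mod C Γ)) (_ : SphericalCategory (Mod C Γ)),
      (∀ {Y : Mod C Γ} (h : Y ⟶ Y), unitScalar F (ribbonTrace h.hom) =
        ribbonDim F Γ * unitScalar F (rightTrace h)) ∧
      globalDim (sphericalDim F : Mod C Γ → F) =
        (ribbonDim F Γ)⁻¹ * globalDim (ribbonDim F : C → F) := by
  have hsimple := hC.nonempty_simpleDecomposition
  have hgen := hasGeneralizedInverses_of_decomposition hsimple
  obtain ⟨a, ha, hmul⟩ := hΓ.comul_mul
  obtain ⟨b, hb, hcounit⟩ := hΓ.unit_counit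
  let S : SeparableFrobenius Γ := .ofIsStronglySeparable hΓ ha hmul
  have hScounit : η[Γ] ≫ S.counit = (a * b) • 𝟙 (𝟙_ C) := by
    change η[Γ] ≫ (a • ε[Γ]) = _
    rw [Linear.comp_smul, hcounit, smul_smul]
  have hone : η[Γ] ≠ 0 := fun h => by
    rw [h, zero_comp] at hcounit
    exact hb (hC.end_unit.1 (hcounit.symm.trans (zero_smul F _).symm))
  have hspan (x : 𝟙_ C ⟶ Γ) : ∃ c : F, c • η[Γ] = x :=
    (finrank_eq_one_iff_of_nonzero' η[Γ] hone).1 hunit x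
  have hθ : (RibbonCategory.twist Γ).hom = 𝟙 Γ := by
    obtain ⟨c, hc⟩ := hspan S.twistElement
    -- If c were zero, d(Γ) = counit(c·1) would vanish.
    refine S.twist_eq_id (F := F) (c := c) (fun h0 => hdim ?_) hc.symm
    rw [ribbonDim, S.ribbonTrace_id_eq, ← hc, h0, zero_smul, zero_comp, ← zero_smul F (𝟙 (𝟙_ C)),
      unitScalar_smul_id hC.end_unit.1]
  have hend := Mod.end_unit_bijective (F := F) hone hspan
  have hgenMod : HasGeneralizedInverses (Mod C Γ) := Mod.hasGeneralizedInverses S hgen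
  have (X Y : C) : Module.Finite F (X ⟶ Y) := hC.finite_hom X Y
  have (M N : Mod C Γ) : Module.Finite F (M ⟶ N) := Mod.finite_hom F M N
  have hsimpleMod (M : Mod C Γ) : Nonempty (SimpleDecomposition M) :=
    hgenMod.nonempty_simpleDecomposition F M
  have : HasKernels (Mod C Γ) := ⟨fun f => hgenMod.hasKernel f⟩
  have hfinMod : Finite (SimpleClass (Mod C Γ)) := Mod.finite_simpleClass hsimple hsimpleMod
  have htrace := @Mod.unitScalar_ribbonTrace F _ C _ _ _ _ _ _ _ _ _ _ Γ _ _ _ _ S hθ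
    hC.end_unit hend
  refine ⟨⟨⟨inferInstance, inferInstance⟩, ⟨hgenMod.abelian, rfl⟩,
    fun M => (hsimpleMod M).some.exists_bicone, inferInstance, hend⟩, hfinMod, Mod.rightRigid S,
    Mod.spherical S hθ fun f g hfg => ?_, htrace, ?_⟩
  · obtain ⟨c, rfl⟩ := hend.2 f
    obtain ⟨d, rfl⟩ := hend.2 g
    -- Unit and counit of Γ compose to the nonzero scalar ab, so closing off is injective on
    -- endomorphisms of the unit module.
    rw [Mod.one_smul_counitMod, Mod.one_smul_counitMod, hScounit, smul_smul, smul_smul] at hfg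
    rw [mul_right_cancel₀ (mul_ne_zero ha hb) (hC.end_unit.1 hfg)]
  · have := Fintype.ofFinite (SimpleClass C)
    have := Fintype.ofFinite (SimpleClass (Mod C Γ))
    have hsq := Mod.sum_sq_ribbonDim (F := F) hsimple hsimpleMod hC.end_unit
    rw [globalDim, globalDim, finsum_eq_sum_of_fintype, finsum_eq_sum_of_fintype,
      eq_inv_mul_iff_mul_eq₀ hdim]
    -- A second factor d(Γ) is needed because d(Y) = d(Γ) Tr_Γ(id) enters squared.
    apply mul_left_cancel₀ hdim
    rw [← hsq, Finset.mul_sum, Finset.mul_sum]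
    refine Finset.sum_congr rfl fun y _ => ?_
    have hy : ribbonDim F y.rep.X = ribbonDim F Γ * _ := htrace (𝟙 y.rep)
    rw [hy, mul_pow, pow_two (ribbonDim F Γ), mul_assoc]
    rfl
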